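/- **Setting.** Let $w_0:[0,\infty)\to[0,\infty)$ be decreasing, right-continuous and integrable with $\int_0^\infty w_0(x)\,dx=1$. Put $a_0=\sup\{x\ge 0: w_0(x)>0\}\in(0,\infty]$ and $h_0(x)=\int_x^\infty w_0(x')\,dx'$. Assume that $h_0$ is $C^2$ on $[0,a_0)$ (with one-sided derivatives at $0$), and let $$\beta_0(x)=\frac{h_0''(x)\,h_0(x)}{h_0'(x)^2},\qquad 0\le x<a_0 .$$ The LSW system for $w(x,t)$ is $$\frac{\partial w}{\partial t}(x,t)=\Big[1-\Big(\frac{x}{L(t)}\Big)^{1/3}\Big]\frac{\partial w}{\partial x}(x,t),\quad x>0,\ t>0,\qquad \int_0^\infty w(x,t)\,dx=1,$$ where $L(t)>0$ is given by $L(t)^{1/3}=\frac13\int_0^\infty x^{-2/3}w(x,t)\,dx\,\big/\,w(0,t)$. A global solution with initial data $w_0$ is a function $w(x,t)$, $x\ge0$, $t\ge0$, with $w(\cdot,0)=w_0$ such that, for every $t\ge 0$, $w(\cdot,t)$ is nonnegative, decreasing, right-continuous and integrable with $\int_0^\infty w(x,t)\,dx=1$; the function $L$ is continuous on $[0,\infty)$;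 the differential equation holds pointwise at all $x>0$, $t>0$ with $x\ne\sup\{y\ge 0:w(y,t)>0\}$; and $w$ is constant along characteristics, that is, for all $x\ge0$, $t\ge0$ there is a nonnegative solution $x(\cdot)$ of $\frac{dx}{ds}=-\big[1-(x/L(s))^{1/3}\big]$ on $[0,t]$ with $x(t)=x$, and $w(x,t)=w_0(x(0))$. **Proposition.** For every real $\beta_\infty$ there is a constant $C(\beta_\infty)>0$, depending only on $\beta_\infty$, such that for every $w_0$ as above with $\sup\beta_0\le\beta_\infty$ there is a global solution $w$ of the LSW system with initial data $w_0$ which satisfies $$L(t)\le 2L(0)+C(\beta_\infty)\,t\qquad\text{for all } t\ge 0 .$$ -/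

import Mathlib

open Set MeasureTheory

noncomputable section

namespace LSW

/-- The space `E` of integrable nonnegative decreasing functions on `[0,∞)`.  A member is, up to
the factor `w 0`, the function `x ↦ P(X > x)` of a random variable, so it is right continuous.
Only the values on `[0,∞)` matter. -/
structure MemE (w : ℝ → ℝ) : Prop where
  nonneg : ∀ x, 0 ≤ x → 0 ≤ w x
  antitone : AntitoneOn w (Ici 0)
  integrable : IntegrableOn w (Ioi 0)
  rightCont : ∀ x, 0 ≤ x → ContinuousWithinAt w (Ici x) x

/-- `‖X‖_∞` for the random variable `X` associated with `w`: the right end, possibly `∞`, of the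
interval on which `w` is positive. -/
def supportEnd (w : ℝ → ℝ) : EReal :=
  sSup {e : EReal | ∃ x : ℝ, 0 ≤ x ∧ 0 < w x ∧ e = (x : EReal)}

/-- The domain `[0, ‖X‖_∞)` of the beta function. -/
def betaDomain (w : ℝ → ℝ) : Set ℝ :=
  {x : ℝ | 0 ≤ x ∧ (x : EReal) < supportEnd w}

/-- `h(x) = ∫_x^∞ w(x') dx'`. -/
def tail (w : ℝ → ℝ) (x : ℝ) : ℝ := ∫ y in Ioi x, w y

/-- The beta function `h''(x) h(x) / h'(x)^2`; derivatives at `x = 0` are one-sided. -/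
def beta (w : ℝ → ℝ) (x : ℝ) : ℝ :=
  iteratedDerivWithin 2 (tail w) (Ici 0) x * tail w x / (derivWithin (tail w) (Ici 0) x) ^ 2

/-- The parameter `L` with `L^{1/3} = (1/3) ∫_0^∞ x^{-2/3} w(x) dx / w(0)`. -/
def volumeL (w : ℝ → ℝ) : ℝ :=
  ((1 / 3) * (∫ x in Ioi (0 : ℝ), x ^ (-(2 / 3) : ℝ) * w x) / w 0) ^ 3

/-- `X` is a nonnegative solution on `[0,t]` of the characteristic equation
`dX/ds = -[1 - (X / L(s))^{1/3}]`. -/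
def IsCharacteristic (L : ℝ → ℝ) (t : ℝ) (X : ℝ → ℝ) : Prop :=
  ∀ s ∈ Icc 0 t, 0 ≤ X s ∧
    HasDerivWithinAt X (-(1 - (X s / L s) ^ (1 / 3 : ℝ))) (Icc 0 t) s

/-- `w x t` (`x ≥ 0`, `t ≥ 0`) is a global solution of the LSW system with initial data `w₀`,
where `L(t)` is the parameter of `w(·,t)`.

The initial data need not be continuous, let alone differentiable, at the end of its support, so
the transport equation is imposed pointwise at all `x > 0`, `t > 0` off the moving end of the
support, and everywhere in the integrated form that `w` is constant along characteristics. -/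
structure IsGlobalSolution (w₀ : ℝ → ℝ) (w : ℝ → ℝ → ℝ) : Prop where
  initial : ∀ x : ℝ, 0 ≤ x → w x 0 = w₀ x
  memE : ∀ t : ℝ, 0 ≤ t → MemE (fun x => w x t)
  mass : ∀ t : ℝ, 0 ≤ t → ∫ x in Ioi (0 : ℝ), w x t = 1
  L_cont : ContinuousOn (fun t => volumeL (fun x => w x t)) (Ici 0)
  pde : ∀ x t : ℝ, 0 < x → 0 < t → (x : EReal) ≠ supportEnd (fun y => w y t) →
    ∃ wx : ℝ, HasDerivAt (fun y => w y t) wx x ∧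
      HasDerivAt (fun s => w x s)
        ((1 - (x / volumeL (fun y => w y t)) ^ (1 / 3 : ℝ)) * wx) t
  characteristics : ∀ x t : ℝ, 0 ≤ x → 0 ≤ t →
    ∃ X : ℝ → ℝ, IsCharacteristic (fun s => volumeL (fun y => w y s)) t X ∧
      X t = x ∧ w x t = w₀ (X 0)

end LSW

end

/-!
The unknown is the rate `μ = L ^ (-1/3)`.  Given `μ`, the profile `w(·,t)` is `w₀` composed with
the map that follows characteristics back from time `t` to time `0`.  Since the cube root is
concave, this map is convex, and the bound on `β₀`, in the integrated form
`1 / w(y) - 1 / w(x) ≤ B (y - x) / h(y)`, yields the same bound at later times.  It follows that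
the mean size `1 / w(0,t)` grows at most linearly, and that `w(·,t)` is at least `w(0,t) / (1 + B)`
on a stretch comparable to the mean size.  The latter bounds `∫ x ^ (-2/3) w(x,t) dx` from below.

The formula for `L` makes `μ` a fixed point of a causal operator, which need not be continuous since
`w₀` may jump at the end of its support.  Truncating its numerator and denominator gives an operator
with a fixed point.  As long as the formula for `L` holds, mass is conserved, and the bounds above
then keep the truncation strictly inactive, so that the formula continues to hold.
-/

noncomputable section

namespace LSW

open Filter Topology

section CubeRoot

/-- The cube root of the positive part. -/
def cbrt (x : ℝ) : ℝ := (max x 0) ^ (1 / 3 : ℝ)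

lemma cbrt_nonneg (x : ℝ) : 0 ≤ cbrt x := Real.rpow_nonneg (le_max_right _ _) _

lemma monotone_cbrt : Monotone cbrt := fun _ _ h =>
  Real.rpow_le_rpow (le_max_right _ _) (max_le_max_right 0 h) (by norm_num)

@[fun_prop]
lemma continuous_cbrt : Continuous cbrt :=
  (continuous_id.max continuous_const).rpow_const fun _ => Or.inr (by norm_num)

lemma cbrt_of_nonpos {x : ℝ} (hx : x ≤ 0) : cbrt x = 0 := by
  rw [cbrt, max_eq_right hx, Real.zero_rpow (by norm_num)]

lemma cbrt_eq_rpow {x : ℝ} (hx : 0 ≤ x) : cbrt x = x ^ (1 / 3 : ℝ) := by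
  rw [cbrt, max_eq_left hx]

lemma cbrt_pow_three {x : ℝ} (hx : 0 ≤ x) : cbrt x ^ 3 = x := by
  rw [cbrt_eq_rpow hx, ← Real.rpow_natCast, ← Real.rpow_mul hx]
  norm_num

lemma cbrt_pos {x : ℝ} (hx : 0 < x) : 0 < cbrt x := by
  rw [cbrt_eq_rpow hx.le]; exact Real.rpow_pos_of_pos hx _

lemma cbrt_cube {x : ℝ} (hx : 0 ≤ x) : cbrt (x ^ 3) = x :=
  (pow_left_inj₀ (cbrt_nonneg _) hx (by norm_num)).1 (cbrt_pow_three (pow_nonneg hx 3))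

lemma lt_cbrt_iff {x y : ℝ} (hy : 0 ≤ y) : y < cbrt x ↔ y ^ 3 < x := by
  rcases le_or_gt x 0 with hx | hx
  · rw [cbrt_of_nonpos hx]
    exact ⟨fun h => absurd h hy.not_gt, fun h => absurd h (hx.trans (pow_nonneg hy 3)).not_gt⟩
  · rw [← pow_lt_pow_iff_left₀ hy (cbrt_nonneg x) (n := 3) (by norm_num), cbrt_pow_three hx.le]

lemma hasDerivAt_cbrt {x : ℝ} (hx : 0 < x) : HasDerivAt cbrt (1 / (3 * cbrt x ^ 2)) x := by
  have hderiv : (1 / 3 : ℝ) * x ^ (1 / 3 - 1 : ℝ) = 1 / (3 * cbrt x ^ 2) := by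
    rw [cbrt_eq_rpow hx.le, ← Real.rpow_natCast, ← Real.rpow_mul hx.le,
      show (1 / 3 - 1 : ℝ) = -(1 / 3 * (2 : ℕ)) by norm_num, Real.rpow_neg hx.le]
    field_simp
  refine ((Real.hasDerivAt_rpow_const (Or.inl hx.ne')).congr_deriv hderiv).congr_of_eventuallyEq ?_
  filter_upwards [lt_mem_nhds hx] with y hy using cbrt_eq_rpow hy.le

/-- The denominator in the divided difference of the cube root, see `cbrt_sub_cbrt`. -/
def cbrtDen (x y : ℝ) : ℝ := cbrt x ^ 2 + cbrt x * cbrt y + cbrt y ^ 2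

lemma cbrtDen_pos {x y : ℝ} (h : 0 < x ∨ 0 < y) : 0 < cbrtDen x y := by
  have hx := cbrt_nonneg x
  have hy := cbrt_nonneg y
  rcases h with h | h <;> have := cbrt_pos h <;> unfold cbrtDen <;> positivity

lemma cbrt_sq_le_cbrtDen (x y : ℝ) : cbrt x ^ 2 ≤ cbrtDen x y := by
  have hxy := mul_nonneg (cbrt_nonneg x) (cbrt_nonneg y)
  unfold cbrtDen
  linarith [sq_nonneg (cbrt y)]

lemma cbrtDen_mono {x y x' y' : ℝ} (hx : x ≤ x') (hy : y ≤ y') : cbrtDen x y ≤ cbrtDen x' y' := by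
  have hx0 := cbrt_nonneg x
  have hy0 := cbrt_nonneg y
  have hx0' := cbrt_nonneg x'
  have hcx := monotone_cbrt hx
  have hcy := monotone_cbrt hy
  unfold cbrtDen
  gcongr

lemma continuous_cbrtDen : Continuous fun p : ℝ × ℝ => cbrtDen p.1 p.2 := by
  unfold cbrtDen
  fun_prop

lemma cbrt_sub_cbrt {x y : ℝ} (hx : 0 ≤ x) (hy : 0 ≤ y) (h : 0 < x ∨ 0 < y) :
    cbrt x - cbrt y = (x - y) / cbrtDen x y := by
  rw [eq_div_iff (cbrtDen_pos h).ne', cbrtDen]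
  linear_combination cbrt_pow_three hx - cbrt_pow_three hy

end CubeRoot

section CausalOperators

lemma tendsto_comp_sub_of_equicontinuousAt {ι E : Type*} [PseudoMetricSpace E] {v : ι → ℝ → E}
    {l : Filter ι} {ε : ι → ℝ} {t : ℝ} {e : E} (hequi : EquicontinuousAt v t)
    (hv : Tendsto (fun i => v i t) l (𝓝 e)) (hε : Tendsto ε l (𝓝 0)) :
    Tendsto (fun p : ι × ℝ => v p.1 (p.2 - ε p.1)) (l ×ˢ 𝓝 t) (𝓝 e) := by
  have hshift : Tendsto (fun p : ι × ℝ => p.2 - ε p.1) (l ×ˢ 𝓝 t) (𝓝 t) := by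
    simpa using tendsto_snd.sub (hε.comp tendsto_fst)
  refine Metric.tendsto_nhds.2 fun δ hδ => ?_
  filter_upwards [
    hshift.eventually (Metric.equicontinuousAt_iff_right.1 hequi (δ / 2) (half_pos hδ)),
    tendsto_fst.eventually (Metric.tendsto_nhds.1 hv (δ / 2) (half_pos hδ))] with p hnear hfar
  have := dist_triangle_left (v p.1 (p.2 - ε p.1)) e (v p.1 t)
  linarith [hnear p.1]

variable {E : Type*} [MetricSpace E] [Nonempty E] {Φ : C(ℝ, E) → C(ℝ, E)}

lemma exists_eq_delay_of_causal
    (hcausal : ∀ u v : C(ℝ, E), ∀ t, (∀ s ∈ Ico 0 t, u s = v s) → Φ u t = Φ v t)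
    {ε : ℝ} (hε : 0 < ε) (T : ℝ) : ∃ u : C(ℝ, E), ∀ t ≤ T, u t = Φ u (t - ε) := by
  let D (u : C(ℝ, E)) : C(ℝ, E) := ⟨fun t => Φ u (t - ε), by fun_prop⟩
  have hsteps : ∀ n : ℕ, ∃ u : C(ℝ, E), ∀ t ≤ n * ε, u t = Φ u (t - ε) := by
    intro n
    induction n with
    | zero =>
      obtain ⟨e⟩ := ‹Nonempty E›
      refine ⟨D (.const ℝ e), fun t ht => hcausal _ _ _ fun s hs => ?_⟩
      rw [Nat.cast_zero, zero_mul] at ht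
      linarith [hs.1, hs.2]
    | succ n ih =>
      obtain ⟨u, hu⟩ := ih
      refine ⟨D u, fun t ht => hcausal _ _ _ fun s hs => hu s ?_⟩
      push_cast at ht
      linarith [hs.2]
  obtain ⟨n, hn⟩ := exists_nat_ge (T / ε)
  obtain ⟨u, hu⟩ := hsteps n
  exact ⟨u, fun t ht => hu t (ht.trans ((div_le_iff₀ hε).1 hn))⟩

-- Tonelli's method: solutions of the delayed equations exist stepwise, and equicontinuity lets the
-- delay tend to zero along an ultrafilter.
theorem exists_fixedPoint_of_causal (hcont : ∀ t, Continuous fun u => Φ u t)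
    (hcausal : ∀ u v : C(ℝ, E), ∀ t, (∀ s ∈ Ico 0 t, u s = v s) → Φ u t = Φ v t)
    (hequi : Equicontinuous fun u => (Φ u : ℝ → E))
    (hcompact : ∀ t, ∃ K, IsCompact K ∧ ∀ u, Φ u t ∈ K) :
    ∃ u, Φ u = u := by
  choose u hu using fun n : ℕ =>
    exists_eq_delay_of_causal hcausal (Nat.one_div_pos_of_nat (α := ℝ) (n := n)) n
  have hlim : ∀ t, ∃ l, Tendsto (fun n => Φ (u n) t) (hyperfilter ℕ) (𝓝 l) := by
    intro t
    obtain ⟨K, hK, hΦK⟩ := hcompact t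
    obtain ⟨l, -, hl⟩ := hK.ultrafilter_le_nhds ((hyperfilter ℕ).map fun n => Φ (u n) t)
      (tendsto_principal.2 (Eventually.of_forall fun n => hΦK (u n)))
    exact ⟨l, hl⟩
  choose l hl using hlim
  have hequi' : Equicontinuous fun n => (Φ (u n) : ℝ → E) := fun t => (hequi t).comp u
  let L : C(ℝ, E) := ⟨l, (tendsto_pi_nhds.2 hl).continuous_of_equicontinuous hequi'⟩
  have hdelay : Tendsto (fun n : ℕ => 1 / ((n : ℝ) + 1)) (hyperfilter ℕ) (𝓝 0) :=
    tendsto_one_div_add_atTop_nhds_zero_nat.mono_left Nat.hyperfilter_le_atTop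
  have hjoint : ∀ t, Tendsto (fun p : ℕ × ℝ => u p.1 p.2) (hyperfilter ℕ ×ˢ 𝓝 t) (𝓝 (l t)) := by
    intro t
    have hbounded : ∀ᶠ p : ℕ × ℝ in hyperfilter ℕ ×ˢ 𝓝 t, p.2 ≤ p.1 := by
      filter_upwards [tendsto_fst.eventually (Nat.hyperfilter_le_atTop
        (eventually_ge_atTop ⌈t + 1⌉₊)),
        tendsto_snd.eventually (ge_mem_nhds (lt_add_one t))] with p hn ht
      exact ht.trans ((Nat.le_ceil _).trans (by exact_mod_cast hn))
    refine (tendsto_comp_sub_of_equicontinuousAt (hequi' t) (hl t) hdelay).congr' ?_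
    exact hbounded.mono fun p hle => (hu p.1 p.2 hle).symm
  have hconv : Tendsto u (hyperfilter ℕ) (𝓝 L) := by
    rw [ContinuousMap.tendsto_iff_tendstoLocallyUniformly,
      tendstoLocallyUniformly_iff_forall_tendsto]
    intro t
    have hL : Tendsto (fun p : ℕ × ℝ => L p.2) (hyperfilter ℕ ×ˢ 𝓝 t) (𝓝 (l t)) :=
      (L.continuous.tendsto t).comp tendsto_snd
    exact (hL.prodMk_nhds (hjoint t)).mono_right (nhds_le_uniformity (l t))
  exact ⟨L, ContinuousMap.ext fun t =>
    tendsto_nhds_unique (((hcont t).tendsto L).comp hconv) (hl t)⟩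

end CausalOperators

section Peano

variable {E : Type*} [NormedAddCommGroup E] [NormedSpace ℝ E] [ProperSpace E]

theorem exists_forall_hasDerivAt_of_norm_le {F : ℝ → E → E} (hF : Continuous (Function.uncurry F))
    {m : ℝ → ℝ} (hm : Continuous m) (hFm : ∀ s y, ‖F s y‖ ≤ m s) (x : E) :
    ∃ Y : ℝ → E, Continuous Y ∧ Y 0 = x ∧ ∀ s ≥ 0, HasDerivAt Y (F s (Y s)) s := by
  have hFu (u : C(ℝ, E)) : Continuous fun s => F s (u s) := by fun_prop
  have (u : C(ℝ, E)) : Continuous fun t => ∫ s in (0 : ℝ)..t, F s (u s) :=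
    intervalIntegral.continuous_primitive (fun _ _ => (hFu u).intervalIntegrable _ _) 0
  let Φ (u : C(ℝ, E)) : C(ℝ, E) :=
    ⟨fun t => x + ∫ s in (0 : ℝ)..max t 0, F s (u s), by fun_prop⟩
  have hΦ (u : C(ℝ, E)) (t t' : ℝ) :
      dist (Φ u t) (Φ u t') ≤ |∫ s in max t' 0..max t 0, m s| := by
    rw [dist_eq_norm, ContinuousMap.coe_mk, add_sub_add_left_eq_sub,
      intervalIntegral.integral_interval_sub_left ((hFu u).intervalIntegrable _ _)
        ((hFu u).intervalIntegrable _ _)]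
    exact intervalIntegral.norm_integral_le_abs_of_norm_le (.of_forall fun s => hFm s (u s))
      (hm.intervalIntegrable _ _)
  obtain ⟨u, hu⟩ : ∃ u, Φ u = u := by
    refine exists_fixedPoint_of_causal (fun t => ?_) (fun u v t huv => ?_) (fun t => ?_)
      fun t => ⟨Metric.closedBall x |∫ s in (0 : ℝ)..max t 0, m s|, isCompact_closedBall _ _,
        fun u => ?_⟩
    · refine continuous_const.add
        (intervalIntegral.continuous_parametric_intervalIntegral_of_continuous' ?_ _ _)
      fun_prop
    · refine congrArg (x + ·) (intervalIntegral.integral_congr_Ioo_of_le (le_max_right t 0) ?_)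
      intro s hs
      have hst : s < t := (lt_max_iff.1 hs.2).resolve_right hs.1.not_gt
      simp only [huv s ⟨hs.1.le, hst⟩]
    · refine Metric.equicontinuousAt_of_continuity_modulus
        (fun t' => |∫ s in max t' 0..max t 0, m s|) ?_ _ (.of_forall fun t' u => hΦ u t t')
      have hmc : Continuous fun t' => |∫ s in max t' 0..max t 0, m s| := by
        simp_rw [intervalIntegral.integral_symm (max t 0)]
        have := intervalIntegral.continuous_primitive
          (fun a b => hm.intervalIntegrable (μ := volume) a b) (max t 0)
        fun_prop
      simpa using hmc.tendsto t
    · simpa [Φ] using hΦ u t 0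
  have hu' : ∀ s ≥ 0, u s = x + ∫ r in (0 : ℝ)..s, F r (u r) := fun s hs => by
    rw [← DFunLike.congr_fun hu s, ContinuousMap.coe_mk, max_eq_left hs]
  refine ⟨fun s => x + ∫ r in (0 : ℝ)..s, F r (u r), by fun_prop, by simp, fun s hs => ?_⟩
  simp only [← hu' s hs]
  exact ((hFu u).integral_hasStrictDerivAt 0 s).hasDerivAt.const_add x

end Peano

section Comparison

variable {D D' g : ℝ → ℝ} {a b : ℝ}

lemma le_add_integral_of_deriv_le_of_pos (hab : a ≤ b)
    (hD : ∀ s ∈ Icc a b, HasDerivAt D (D' s) s) (hg : Continuous g) (hg0 : ∀ s, 0 ≤ g s)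
    (h : ∀ s ∈ Icc a b, 0 < D s → D' s ≤ g s) :
    D b ≤ max (D a) 0 + ∫ u in a..b, g u := by
  -- a barrier with the strictly larger derivative `g + η` cannot be crossed
  have hbarrier : ∀ η > 0, D b ≤ max (D a) 0 + (∫ u in a..b, g u) + η * (1 + (b - a)) := by
    intro η hη
    set B : ℝ → ℝ := fun x => max (D a) 0 + (∫ u in a..x, g u) + η * (1 + (x - a)) with hB
    have hB' : ∀ x, HasDerivAt B (g x + η) x := fun x => by
      have h1 := (hg.integral_hasStrictDerivAt a x).hasDerivAt.const_add (max (D a) 0)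
      have h2 := (((hasDerivAt_id x).sub_const a).const_add 1).const_mul η
      simpa [Pi.add_def] using h1.fun_add h2
    have hBpos : ∀ x ∈ Ico a b, 0 < B x := fun x hx => by
      have h1 : 0 ≤ ∫ u in a..x, g u := intervalIntegral.integral_nonneg hx.1 fun u _ => hg0 u
      have h2 : 0 < η * (1 + (x - a)) := mul_pos hη (by linarith [hx.1])
      linarith [le_max_right (D a) 0]
    refine image_le_of_deriv_right_lt_deriv_boundary' (B := B)
      (fun x hx => (hD x hx).continuousAt.continuousWithinAt)
      (fun x hx => (hD x (Ico_subset_Icc_self hx)).hasDerivWithinAt) ?_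
      (fun x _ => (hB' x).continuousAt.continuousWithinAt) (fun x _ => (hB' x).hasDerivWithinAt)
      (fun x hx hDx => ?_) ⟨hab, le_rfl⟩
    · simp only [hB, intervalIntegral.integral_same, sub_self]
      linarith [le_max_left (D a) 0]
    · linarith [h x (Ico_subset_Icc_self hx) (hDx ▸ hBpos x hx)]
  have : 0 ≤ b - a := sub_nonneg.2 hab
  refine le_of_forall_pos_le_add fun ε hε => ?_
  have := hbarrier (ε / (1 + (b - a))) (by positivity)
  rwa [div_mul_cancel₀ _ (by positivity)] at this

lemma le_add_integral_of_neg_le_deriv_of_pos (hab : a ≤ b)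
    (hD : ∀ s ∈ Icc a b, HasDerivAt D (D' s) s) (hg : Continuous g) (hg0 : ∀ s, 0 ≤ g s)
    (h : ∀ s ∈ Icc a b, 0 < D s → -g s ≤ D' s) :
    D a ≤ max (D b) 0 + ∫ u in a..b, g u := by
  have hmem : ∀ u ∈ Icc a b, a + b - u ∈ Icc a b := fun u hu =>
    ⟨by linarith [hu.2], by linarith [hu.1]⟩
  have hreflected := le_add_integral_of_deriv_le_of_pos (D := fun u => D (a + b - u))
    (g := fun u => g (a + b - u)) hab (fun u hu => (hD _ (hmem u hu)).comp_const_sub (a + b) u)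
    (hg.comp (by fun_prop)) (fun _ => hg0 _)
    (fun u hu hpos => neg_le.1 (h _ (hmem u hu) hpos))
  simpa [intervalIntegral.integral_comp_sub_left (fun u => g u) (a + b)] using hreflected

lemma le_max_of_deriv_nonneg_of_pos (hab : a ≤ b)
    (hD : ∀ s ∈ Icc a b, HasDerivAt D (D' s) s) (h : ∀ s ∈ Icc a b, 0 < D s → 0 ≤ D' s) :
    D a ≤ max (D b) 0 := by
  simpa using le_add_integral_of_neg_le_deriv_of_pos hab hD (g := fun _ => 0) continuous_const
    (fun _ => le_rfl) (by simpa using h)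

end Comparison

/-- A nonnegative continuous rate; it plays the role of `L^{-1/3}`. -/
structure Rate where
  toFun : ℝ → ℝ
  continuous_toFun : Continuous toFun
  nonneg_toFun : ∀ s, 0 ≤ toFun s

namespace Rate

instance : CoeFun Rate fun _ => ℝ → ℝ := ⟨toFun⟩

@[fun_prop]
lemma continuous (μ : Rate) : Continuous μ := μ.continuous_toFun

lemma nonneg (μ : Rate) (s : ℝ) : 0 ≤ μ s := μ.nonneg_toFun s

lemma exists_bound (μ : Rate) (s t : ℝ) : ∃ M, 0 < M ∧ ∀ u ∈ Icc s t, μ u ≤ M := by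
  obtain ⟨M, hM⟩ := (isCompact_Icc (a := s) (b := t)).bddAbove_image μ.continuous.continuousOn
  exact ⟨max M 1, by positivity, fun u hu => (hM ⟨u, hu, rfl⟩).trans (le_max_left _ _)⟩

end Rate

/-- `X` solves the characteristic equation `X' = -1 + μ X^{1/3}` up to the time `t`; at negative
values of `X` the cube root is replaced by `0`, which lets every trajectory be followed backwards
indefinitely. -/
def IsTrajectory (μ : Rate) (t : ℝ) (X : ℝ → ℝ) : Prop :=
  ∀ s ≤ t, HasDerivAt X (-1 + μ s * cbrt (X s)) s

lemma exists_isTrajectory (μ : Rate) (t x : ℝ) :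
    ∃ X : ℝ → ℝ, Continuous X ∧ X t = x ∧ IsTrajectory μ t X := by
  set F : ℝ → ℝ → ℝ := fun s y => 1 - μ (t - s) * cbrt (min y (|x| + |s|)) with hF
  have hFc : Continuous (Function.uncurry F) := by
    unfold Function.uncurry
    fun_prop
  have hFm : ∀ s y, ‖F s y‖ ≤ 1 + μ (t - s) * cbrt (|x| + |s|) := fun s y => by
    have h1 := mul_nonneg (μ.nonneg (t - s)) (cbrt_nonneg (min y (|x| + |s|)))
    have h2 := mul_le_mul_of_nonneg_left (monotone_cbrt (min_le_right y (|x| + |s|)))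
      (μ.nonneg (t - s))
    rw [Real.norm_eq_abs, abs_le]
    constructor <;> linarith
  obtain ⟨Y, hYc, hY0, hY⟩ := exists_forall_hasDerivAt_of_norm_le hFc (by fun_prop) hFm x
  have hYle : ∀ s ≥ 0, Y s ≤ |x| + |s| := fun s hs => by
    have hYsub := le_add_integral_of_deriv_le_of_pos (D := fun s => Y s - x - s) hs
      (fun u hu => ((hY u hu.1).sub_const x).sub (hasDerivAt_id u)) (g := fun _ => 0)
      continuous_const (fun _ => le_rfl) fun u _ _ => by
        have := mul_nonneg (μ.nonneg (t - u)) (cbrt_nonneg (min (Y u) (|x| + |u|)))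
        simp only [hF]
        linarith
    simp only [hY0, sub_self, max_self, intervalIntegral.integral_zero, add_zero] at hYsub
    linarith [le_abs_self x, le_abs_self s]
  refine ⟨fun s => Y (t - s), by fun_prop, by simpa using hY0, fun s hs => ?_⟩
  refine ((hY (t - s) (sub_nonneg.2 hs)).comp_const_sub t s).congr_deriv ?_
  simp only [hF, min_eq_left (hYle _ (sub_nonneg.2 hs)), sub_sub_cancel]
  ring

/-- The characteristic through `x` at time `t`, as a function of time. -/
def flow (μ : Rate) (t x : ℝ) : ℝ → ℝ := (exists_isTrajectory μ t x).choose

section Flow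

variable {μ : Rate} {s t x y : ℝ}

@[fun_prop]
lemma continuous_flow : Continuous (flow μ t x) := (exists_isTrajectory μ t x).choose_spec.1

@[simp]
lemma flow_self : flow μ t x t = x := (exists_isTrajectory μ t x).choose_spec.2.1

lemma isTrajectory_flow : IsTrajectory μ t (flow μ t x) :=
  (exists_isTrajectory μ t x).choose_spec.2.2

namespace IsTrajectory

lemma mono {X : ℝ → ℝ} (h : IsTrajectory μ t X) (hs : s ≤ t) : IsTrajectory μ s X :=
  fun u hu => h u (hu.trans hs)

lemma sub_le {μ' : Rate} {X Y : ℝ → ℝ} (hX : IsTrajectory μ t X) (hY : IsTrajectory μ' t Y)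
    (hYc : Continuous Y) (hs : s ≤ t) :
    X s - Y s ≤ max (X t - Y t) 0 + ∫ u in s..t, |μ u - μ' u| * cbrt (Y u) := by
  refine le_add_integral_of_neg_le_deriv_of_pos (D := fun s => X s - Y s) hs
    (fun u hu => (hX u hu.2).sub (hY u hu.2)) (by fun_prop)
    (fun _ => mul_nonneg (abs_nonneg _) (cbrt_nonneg _)) (fun u _ hpos => ?_)
  have h1 := mul_le_mul_of_nonneg_left (monotone_cbrt (sub_pos.1 hpos).le) (μ.nonneg u)
  have h2 := mul_le_mul_of_nonneg_right (neg_abs_le (μ u - μ' u)) (cbrt_nonneg (Y u))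
  linarith

lemma sub_le_max {X Y : ℝ → ℝ} (hX : IsTrajectory μ t X) (hY : IsTrajectory μ t Y) (hs : s ≤ t) :
    X s - Y s ≤ max (X t - Y t) 0 := by
  refine le_max_of_deriv_nonneg_of_pos (D := fun s => X s - Y s) hs
    (fun u hu => (hX u hu.2).sub (hY u hu.2)) fun u _ hpos => ?_
  linarith [mul_le_mul_of_nonneg_left (monotone_cbrt (sub_pos.1 hpos).le) (μ.nonneg u)]

lemma le_of_le {X Y : ℝ → ℝ} (hX : IsTrajectory μ t X) (hY : IsTrajectory μ t Y) (h : X t ≤ Y t)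
    (hs : s ≤ t) : X s ≤ Y s := by
  simpa [max_eq_right (sub_nonpos.2 h)] using hX.sub_le_max hY hs

lemma eq_flow {X : ℝ → ℝ} (hX : IsTrajectory μ t X) (hs : s ≤ t) : X s = flow μ t (X t) s :=
  le_antisymm (hX.le_of_le isTrajectory_flow flow_self.ge hs)
    (isTrajectory_flow.le_of_le hX flow_self.le hs)

end IsTrajectory

lemma flow_mono (hs : s ≤ t) : Monotone fun x => flow μ t x s := fun x y hxy =>
  isTrajectory_flow.le_of_le isTrajectory_flow (by simpa using hxy) hs

lemma abs_flow_sub_le (hs : s ≤ t) (x y : ℝ) : |flow μ t x s - flow μ t y s| ≤ |x - y| := by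
  have hle : ∀ x y, flow μ t x s - flow μ t y s ≤ |x - y| := fun x y => by
    have h := (isTrajectory_flow (μ := μ) (x := x)).sub_le_max (isTrajectory_flow (x := y)) hs
    rw [flow_self, flow_self] at h
    exact h.trans (max_le (le_abs_self _) (abs_nonneg _))
  exact abs_sub_le_iff.2 ⟨hle x y, abs_sub_comm x y ▸ hle y x⟩

lemma continuous_flow_left (hs : s ≤ t) : Continuous fun x => flow μ t x s :=
  (LipschitzWith.of_dist_le_mul (K := 1) fun x y => by
    simpa [Real.dist_eq] using abs_flow_sub_le hs x y).continuous

lemma flow_flow {r : ℝ} (hs : s ≤ r) (hr : r ≤ t) (x : ℝ) :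
    flow μ r (flow μ t x r) s = flow μ t x s :=
  ((isTrajectory_flow.mono hr).eq_flow hs).symm

lemma flow_le_add (hs : s ≤ t) (x : ℝ) : flow μ t x s ≤ x + (t - s) := by
  have := le_max_of_deriv_nonneg_of_pos (D := fun s => flow μ t x s + s - (x + t)) hs
    (fun u hu => ((isTrajectory_flow u hu.2).add (hasDerivAt_id u)).sub_const _)
    fun u _ _ => by
      have := mul_nonneg (μ.nonneg u) (cbrt_nonneg (flow μ t x u))
      linarith
  simp only [flow_self, sub_self, max_self] at this
  linarith

lemma min_le_flow {c : ℝ} (hs : s ≤ t) (hc : ∀ u ∈ Icc s t, μ u * cbrt c ≤ 1) (x : ℝ) :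
    min x c ≤ flow μ t x s := by
  have := le_max_of_deriv_nonneg_of_pos (D := fun s => min x c - flow μ t x s) hs
    (fun u hu => (isTrajectory_flow u hu.2).const_sub _) fun u hu hpos => by
      have hflow : flow μ t x u ≤ c := (sub_pos.1 hpos).le.trans (min_le_right _ _)
      linarith [hc u hu, mul_le_mul_of_nonneg_left (monotone_cbrt hflow) (μ.nonneg u)]
  simpa using this

lemma flow_nonneg (hs : s ≤ t) (hx : 0 ≤ x) : 0 ≤ flow μ t x s := by
  simpa [hx] using min_le_flow (μ := μ) hs (c := 0) (by simp [cbrt_of_nonpos le_rfl]) x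

lemma min_inv_cube_le_flow {M : ℝ} (hs : s ≤ t) (hM : 0 < M) (hμ : ∀ u ∈ Icc s t, μ u ≤ M)
    (x : ℝ) : min x ((1 / M) ^ 3) ≤ flow μ t x s := by
  refine min_le_flow hs (fun u hu => ?_) x
  rw [cbrt_cube (by positivity), mul_one_div, div_le_one hM]
  exact hμ u hu

lemma flow_pos (hs : s ≤ t) (hx : 0 < x) : 0 < flow μ t x s := by
  obtain ⟨M, hM, hμ⟩ := μ.exists_bound s t
  exact (lt_min hx (by positivity)).trans_le (min_inv_cube_le_flow hs hM hμ x)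

lemma cbrt_sq_le_cbrt_flow_sq_add {M : ℝ} (hs : s ≤ t) (hμ : ∀ u ∈ Icc s t, μ u ≤ M) (x : ℝ) :
    cbrt x ^ 2 ≤ cbrt (flow μ t x s) ^ 2 + 2 / 3 * M * (t - s) := by
  have hM : 0 ≤ M := (μ.nonneg s).trans (hμ s ⟨le_rfl, hs⟩)
  have := sub_nonneg.2 hs
  rcases le_or_gt x 0 with hx | hx
  · rw [cbrt_of_nonpos hx, zero_pow two_ne_zero]
    positivity
  have hderiv : ∀ u ≤ t, HasDerivAt (fun u => cbrt (flow μ t x u) ^ 2)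
      (2 / 3 * μ u - 2 / 3 / cbrt (flow μ t x u)) u := fun u hu => by
    have hpos := cbrt_pos (flow_pos (μ := μ) hu hx)
    refine (((hasDerivAt_cbrt (flow_pos hu hx)).comp u (isTrajectory_flow u hu)).pow 2).congr_deriv
      ?_
    simp only [Function.comp_apply]
    field
  have := le_add_integral_of_neg_le_deriv_of_pos (g := fun _ => 2 / 3 * M) hs
    (D := fun s => cbrt x ^ 2 - cbrt (flow μ t x s) ^ 2)
    (fun u hu => (hderiv u hu.2).const_sub _) continuous_const (fun _ => by positivity)
    fun u hu _ => by
      have hpos := cbrt_pos (flow_pos (μ := μ) hu.2 hx)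
      have : 0 < 2 / 3 / cbrt (flow μ t x u) := by positivity
      linarith [hμ u hu]
  simp only [flow_self, sub_self, max_self, intervalIntegral.integral_const, smul_eq_mul] at this
  linarith

lemma cube_le_flow {M ρ : ℝ} (hs : s ≤ t) (hμ : ∀ u ∈ Icc s t, μ u ≤ M) (hρ : 0 ≤ ρ) :
    ρ ^ 3 ≤ flow μ t ((ρ + √(2 / 3 * M * (t - s))) ^ 3) s := by
  have hM : 0 ≤ M := (μ.nonneg s).trans (hμ s ⟨le_rfl, hs⟩)
  have := sub_nonneg.2 hs
  set a := √(2 / 3 * M * (t - s))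
  have ha0 : 0 ≤ a := Real.sqrt_nonneg _
  have ha2 : a ^ 2 = 2 / 3 * M * (t - s) := Real.sq_sqrt (by positivity)
  have h := cbrt_sq_le_cbrt_flow_sq_add hs hμ ((ρ + a) ^ 3)
  rw [cbrt_cube (by positivity), ← ha2] at h
  have hroot : ρ ≤ cbrt (flow μ t ((ρ + a) ^ 3) s) := by
    refine (pow_le_pow_iff_left₀ hρ (cbrt_nonneg _) two_ne_zero).1 ?_
    nlinarith [mul_nonneg hρ ha0]
  calc ρ ^ 3 ≤ cbrt (flow μ t ((ρ + a) ^ 3) s) ^ 3 := pow_le_pow_left₀ hρ hroot 3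
    _ = _ := cbrt_pow_three (flow_nonneg hs (by positivity))

lemma surjective_flow (hs : s ≤ t) : Function.Surjective fun x => flow μ t x s := by
  obtain ⟨M, -, hμ⟩ := μ.exists_bound s t
  refine (continuous_flow_left hs).surjective (tendsto_atTop.2 fun b => ?_)
    (tendsto_atBot_mono (flow_le_add hs) (tendsto_atBot_add_const_right _ _ tendsto_id))
  filter_upwards [eventually_ge_atTop ((max b 1 + √(2 / 3 * M * (t - s))) ^ 3)] with x hx
  calc b ≤ max b 1 := le_max_left _ _
    _ ≤ max b 1 ^ 3 := le_self_pow₀ (le_max_right _ _) (by norm_num)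
    _ ≤ _ := cube_le_flow hs hμ (by positivity)
    _ ≤ _ := flow_mono hs hx

end Flow

/-- The difference quotient of `x ↦ flow μ t x 0` between the nonnegative points `x` and `y`, not
both zero. -/
def flowSlope (μ : Rate) (t x y : ℝ) : ℝ :=
  Real.exp (-∫ s in (0 : ℝ)..t, μ s / cbrtDen (flow μ t x s) (flow μ t y s))

section FlowSlope

variable {μ : Rate} {s t x y : ℝ}

lemma flowSlope_pos (μ : Rate) (t x y : ℝ) : 0 < flowSlope μ t x y := Real.exp_pos _

lemma cbrtDen_flow_pos (h : 0 < x ∨ 0 < y) (hs : s ≤ t) :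
    0 < cbrtDen (flow μ t x s) (flow μ t y s) :=
  cbrtDen_pos (h.imp (flow_pos hs) (flow_pos hs))

lemma continuousOn_div_cbrtDen_flow (h : 0 < x ∨ 0 < y) :
    ContinuousOn (fun s => μ s / cbrtDen (flow μ t x s) (flow μ t y s)) (Iic t) :=
  μ.continuous.continuousOn.div
    (continuous_cbrtDen.comp (continuous_flow.prodMk continuous_flow)).continuousOn
    fun _ hs => (cbrtDen_flow_pos h hs).ne'

lemma intervalIntegrable_div_cbrtDen_flow (ht : 0 ≤ t) (h : 0 < x ∨ 0 < y) :
    IntervalIntegrable (fun s => μ s / cbrtDen (flow μ t x s) (flow μ t y s)) volume 0 t :=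
  ((continuousOn_div_cbrtDen_flow h).mono Icc_subset_Iic_self).intervalIntegrable_of_Icc ht

lemma flow_sub_flow (ht : 0 ≤ t) (hx : 0 ≤ x) (hy : 0 ≤ y) (h : 0 < x ∨ 0 < y) :
    flow μ t x 0 - flow μ t y 0 = flowSlope μ t x y * (x - y) := by
  set f := fun s => μ s / cbrtDen (flow μ t x s) (flow μ t y s) with hf
  have hfc : Continuous fun s => f (min s t) :=
    (continuousOn_div_cbrtDen_flow h).comp_continuous (by fun_prop) fun s => min_le_right s t
  have hfd : ∀ s, HasDerivAt (fun s => ∫ u in (0 : ℝ)..s, f (min u t)) (f (min s t)) s :=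
    fun s => (hfc.integral_hasStrictDerivAt 0 s).hasDerivAt
  have hderiv : ∀ s ≤ t, HasDerivAt (fun s => (flow μ t x s - flow μ t y s) *
      Real.exp (-∫ u in (0 : ℝ)..s, f (min u t))) 0 s := fun s hs => by
    have hsub : μ s * cbrt (flow μ t x s) - μ s * cbrt (flow μ t y s) =
        f s * (flow μ t x s - flow μ t y s) := by
      rw [← mul_sub, cbrt_sub_cbrt (flow_nonneg hs hx) (flow_nonneg hs hy)
        (h.imp (flow_pos hs) (flow_pos hs))]
      simp only [hf]
      ring
    refine (((isTrajectory_flow s hs).sub (isTrajectory_flow s hs)).mul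
      (hfd s).neg.exp).congr_deriv ?_
    simp only [Pi.sub_apply, Pi.neg_apply, min_eq_left hs]
    linear_combination Real.exp (-∫ u in (0 : ℝ)..s, f (min u t)) * hsub
  have hconst := constant_of_has_deriv_right_zero
    (fun s hs => (hderiv s hs.2).continuousAt.continuousWithinAt)
    (fun s hs => (hderiv s hs.2.le).hasDerivWithinAt) t ⟨ht, le_rfl⟩
  have hint : ∫ u in (0 : ℝ)..t, f (min u t) = ∫ u in (0 : ℝ)..t, f u :=
    intervalIntegral.integral_congr_Ioo_of_le ht fun u hu => by simp only [min_eq_left hu.2.le]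
  simp only [flow_self, hint, intervalIntegral.integral_same, neg_zero, Real.exp_zero,
    mul_one] at hconst
  rw [← hconst, flowSlope, mul_comm]

lemma flowSlope_mono {x' y' : ℝ} (ht : 0 ≤ t) (h : 0 < x ∨ 0 < y) (hx : x ≤ x') (hy : y ≤ y') :
    flowSlope μ t x y ≤ flowSlope μ t x' y' := by
  have h' : 0 < x' ∨ 0 < y' := h.imp hx.trans_lt' hy.trans_lt'
  refine Real.exp_le_exp.2 (neg_le_neg (intervalIntegral.integral_mono_on ht
    (intervalIntegrable_div_cbrtDen_flow ht h') (intervalIntegrable_div_cbrtDen_flow ht h)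
    fun s hs => ?_))
  exact div_le_div_of_nonneg_left (μ.nonneg s) (cbrtDen_flow_pos h hs.2)
    (cbrtDen_mono (flow_mono hs.2 hx) (flow_mono hs.2 hy))

lemma flow_zero_lt (ht : 0 ≤ t) (hx : 0 ≤ x) (hxy : x < y) : flow μ t x 0 < flow μ t y 0 := by
  have h1 := flow_sub_flow (μ := μ) ht (hx.trans hxy.le) hx (Or.inl (hx.trans_lt hxy))
  have h2 := mul_pos (flowSlope_pos μ t y x) (sub_pos.2 hxy)
  linarith

-- `flowSlope` is increasing in both points, so `x ↦ flow μ t x 0` is convex.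
lemma flow_add_flowSlope_mul_le {z : ℝ} (ht : 0 ≤ t) (hx : 0 ≤ x) (hxy : x < y) (hyz : y ≤ z) :
    flow μ t y 0 + flowSlope μ t x y * (z - y) ≤ flow μ t z 0 := by
  have hy := hx.trans_lt hxy
  have h1 := flow_sub_flow (μ := μ) ht (hy.le.trans hyz) hy.le (Or.inr hy)
  have h2 : flowSlope μ t x y ≤ flowSlope μ t z y :=
    flowSlope_mono ht (Or.inr hy) (hxy.le.trans hyz) le_rfl
  linarith [mul_le_mul_of_nonneg_right h2 (sub_nonneg.2 hyz)]

lemma exp_neg_le_flowSlope {M : ℝ} (ht : 0 ≤ t) (hM : 0 < M) (hμ : ∀ u ∈ Icc 0 t, μ u ≤ M)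
    (hx : 0 < x) :
    Real.exp (-(M / cbrt (min x ((1 / M) ^ 3)) ^ 2 * t)) ≤ flowSlope μ t x 0 := by
  refine Real.exp_le_exp.2 (neg_le_neg ?_)
  have hc : 0 < cbrt (min x ((1 / M) ^ 3)) := cbrt_pos (lt_min hx (by positivity))
  calc _ ≤ ∫ s in (0 : ℝ)..t, M / cbrt (min x ((1 / M) ^ 3)) ^ 2 := by
        refine intervalIntegral.integral_mono_on ht
          (intervalIntegrable_div_cbrtDen_flow ht (Or.inl hx)) intervalIntegrable_const
          fun s hs => div_le_div₀ hM.le (hμ s hs) (by positivity) ?_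
        calc _ ≤ cbrt (flow μ t x s) ^ 2 := pow_le_pow_left₀ hc.le (monotone_cbrt
              (min_inv_cube_le_flow hs.2 hM (fun u hu => hμ u ⟨hs.1.trans hu.1, hu.2⟩) x)) 2
          _ ≤ _ := cbrt_sq_le_cbrtDen _ _
    _ = _ := by rw [intervalIntegral.integral_const, sub_zero, smul_eq_mul, mul_comm]

end FlowSlope

lemma integrableOn_Ioi_comp_add_right_iff (f : ℝ → ℝ) (a b : ℝ) :
    IntegrableOn (fun x => f (x + b)) (Ioi a) ↔ IntegrableOn f (Ioi (a + b)) := by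
  have h := (measurePreserving_add_right (volume : Measure ℝ) b).integrableOn_comp_preimage
    (measurableEmbedding_addRight b) (f := f) (s := Ioi (a + b))
  rwa [preimage_add_const_Ioi, add_sub_cancel_right] at h

lemma setIntegral_Ioi_comp_add_right (f : ℝ → ℝ) (a b : ℝ) :
    ∫ x in Ioi a, f (x + b) = ∫ x in Ioi (a + b), f x := by
  have h := (measurePreserving_add_right (volume : Measure ℝ) b).setIntegral_preimage_emb
    (measurableEmbedding_addRight b) f (Ioi (a + b))
  rwa [preimage_add_const_Ioi, add_sub_cancel_right] at h

section ShiftComparison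

variable {f g : ℝ → ℝ} {b : ℝ}

lemma integrableOn_Ioi_comp_add_of_le (hf : IntegrableOn f (Ioi 0)) (hg : Antitone g)
    (hg0 : ∀ x, 0 ≤ g x) (h : ∀ x, 0 ≤ x → g (x + b) ≤ f x) :
    IntegrableOn (fun x => g (x + b)) (Ioi 0) := by
  refine Integrable.mono' hf (hg.measurable.comp (measurable_id.add_const b)).aestronglyMeasurable
    (ae_restrict_of_forall_mem measurableSet_Ioi fun x hx => ?_)
  rw [Real.norm_of_nonneg (hg0 _)]
  exact h x (le_of_lt hx)

lemma integrableOn_Ioi_of_comp_add_le (hb : 0 ≤ b) (hf : IntegrableOn f (Ioi 0)) (hg : Antitone g)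
    (hg0 : ∀ x, 0 ≤ g x) (h : ∀ x, 0 ≤ x → g (x + b) ≤ f x) : IntegrableOn g (Ioi 0) := by
  have hshift := integrableOn_Ioi_comp_add_of_le hf hg hg0 h
  rw [integrableOn_Ioi_comp_add_right_iff, zero_add] at hshift
  exact Ioc_union_Ioi_eq_Ioi hb ▸ (hg.intervalIntegrable (a := 0) (b := b)).1.union hshift

lemma setIntegral_Ioi_le_of_comp_add_le (hb : 0 ≤ b) (hf : IntegrableOn f (Ioi 0))
    (hg : Antitone g) (hg0 : ∀ x, 0 ≤ g x) (h : ∀ x, 0 ≤ x → g (x + b) ≤ f x) :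
    ∫ x in Ioi 0, g x ≤ (∫ x in Ioi 0, f x) + b * g 0 := by
  have hsplit := intervalIntegral.integral_Ioi_sub_Ioi
    (integrableOn_Ioi_of_comp_add_le hb hf hg hg0 h) hb
  have htail : ∫ x in Ioi b, g x ≤ ∫ x in Ioi 0, f x := by
    have hshift := setIntegral_Ioi_comp_add_right g 0 b
    rw [zero_add] at hshift
    exact hshift ▸ setIntegral_mono_on (integrableOn_Ioi_comp_add_of_le hf hg hg0 h) hf
      measurableSet_Ioi fun x hx => h x (le_of_lt hx)
  have hhead : ∫ x in (0 : ℝ)..b, g x ≤ ∫ _ in (0 : ℝ)..b, g 0 :=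
    intervalIntegral.integral_mono_on hb hg.intervalIntegrable intervalIntegrable_const
      fun _ hx => hg hx.1
  rw [intervalIntegral.integral_const, sub_zero, smul_eq_mul] at hhead
  linarith

end ShiftComparison

/-- What is used of the initial data `g`, extended to negative arguments by `g 0`.  The last
condition is the integrated form of the bound `B` on the beta function. -/
structure Profile (B : ℝ) (g : ℝ → ℝ) : Prop where
  nonneg : ∀ x, 0 ≤ g x
  antitone : Antitone g
  eq_of_nonpos : ∀ x ≤ 0, g x = g 0
  integrable : IntegrableOn g (Ioi 0)
  integral_eq_one : ∫ x in Ioi 0, g x = 1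
  rightCont : ∀ x, ContinuousWithinAt g (Ici x) x
  continuousAt : ∀ x, 0 < g x → ContinuousAt g x
  differentiableAt : ∀ x, 0 < x → 0 < g x → DifferentiableAt ℝ g x
  inv_sub_inv_le : ∀ x y, 0 ≤ x → x ≤ y → 0 < g y → 1 / g y - 1 / g x ≤ B * (y - x) / tail g y

namespace Profile

variable {B : ℝ} {g : ℝ → ℝ}

lemma le_zero (hg : Profile B g) (x : ℝ) : g x ≤ g 0 := by
  rcases le_total x 0 with h | h
  · exact (hg.eq_of_nonpos x h).le
  · exact hg.antitone h

lemma zero_pos (hg : Profile B g) : 0 < g 0 := by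
  refine (hg.nonneg 0).lt_of_ne fun h => ?_
  have hzero : ∀ x, g x = 0 := fun x => le_antisymm (h ▸ hg.le_zero x) (hg.nonneg x)
  simpa [hzero] using hg.integral_eq_one

lemma integrableOn_Ioi (hg : Profile B g) (y : ℝ) : IntegrableOn g (Ioi y) := by
  refine ((hg.antitone.intervalIntegrable (a := y) (b := 0)).1.union hg.integrable).mono_set
    fun x hx => ?_
  rcases le_or_gt x 0 with h | h
  exacts [Or.inl ⟨hx, h⟩, Or.inr h]

lemma tail_nonneg (hg : Profile B g) (y : ℝ) : 0 ≤ tail g y :=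
  setIntegral_nonneg measurableSet_Ioi fun x _ => hg.nonneg x

lemma mul_le_tail_sub_tail (hg : Profile B g) {x y : ℝ} (hxy : x ≤ y) :
    (y - x) * g y ≤ tail g x - tail g y := by
  calc (y - x) * g y = ∫ _ in x..y, g y := by simp
    _ ≤ ∫ z in x..y, g z := intervalIntegral.integral_mono_on hxy intervalIntegrable_const
      hg.antitone.intervalIntegrable fun z hz => hg.antitone hz.2
    _ = _ := (intervalIntegral.integral_Ioi_sub_Ioi (hg.integrableOn_Ioi x) hxy).symm

lemma tail_zero (hg : Profile B g) : tail g 0 = 1 := hg.integral_eq_one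

lemma tail_eq_zero (hg : Profile B g) {y : ℝ} (h : g y = 0) : tail g y = 0 :=
  setIntegral_eq_zero_of_forall_eq_zero fun x hx =>
    le_antisymm (h ▸ hg.antitone (le_of_lt hx)) (hg.nonneg x)

lemma continuous_tail (hg : Profile B g) : Continuous (tail g) :=
  continuous_iff_continuousAt.2 fun x =>
    (hg.integrableOn_Ioi (x - 1)).continuousOn_Ici_primitive_Ioi.continuousAt
      (Ici_mem_nhds (sub_one_lt x))

lemma integrableOn_cube (hg : Profile B g) : IntegrableOn (fun ρ => g (ρ ^ 3)) (Ioi 0) := by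
  refine integrableOn_Ioi_of_comp_add_le zero_le_one hg.integrable
    (hg.antitone.comp_monotone (Odd.strictMono_pow (by decide)).monotone)
    (fun _ => hg.nonneg _) fun x hx => hg.antitone ?_
  nlinarith [pow_nonneg hx 3, pow_nonneg hx 2]

end Profile

/-- The solution at time `t`: the initial profile `g` transported along the characteristics. -/
def profileAt (g : ℝ → ℝ) (μ : Rate) (t x : ℝ) : ℝ := g (flow μ t x 0)

/-- The integral `1/3 ∫ x^{-2/3} w(x,t) dx`, written in the variable `x^{1/3}`. -/
def radiusSum (g : ℝ → ℝ) (μ : Rate) (t : ℝ) : ℝ := ∫ ρ in Ioi 0, profileAt g μ t (ρ ^ 3)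

section Transport

variable {B : ℝ} {g : ℝ → ℝ} {μ : Rate} {s t : ℝ}

lemma antitone_profileAt (hg : Profile B g) (ht : 0 ≤ t) : Antitone (profileAt g μ t) :=
  hg.antitone.comp_monotone (flow_mono ht)

lemma antitone_profileAt_cube (hg : Profile B g) (ht : 0 ≤ t) :
    Antitone fun ρ => profileAt g μ t (ρ ^ 3) :=
  (antitone_profileAt hg ht).comp_monotone (Odd.strictMono_pow (by decide)).monotone

lemma profileAt_nonneg (hg : Profile B g) (x : ℝ) : 0 ≤ profileAt g μ t x := hg.nonneg _

@[simp]
lemma profileAt_time_zero (x : ℝ) : profileAt g μ 0 x = g x := by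
  rw [profileAt, flow_self]

lemma profileAt_flow (hs : 0 ≤ s) (hst : s ≤ t) (x : ℝ) :
    profileAt g μ s (flow μ t x s) = profileAt g μ t x := by
  rw [profileAt, profileAt, flow_flow hs hst]

lemma profileAt_zero_le (hg : Profile B g) (hs : 0 ≤ s) (hst : s ≤ t) :
    profileAt g μ t 0 ≤ profileAt g μ s 0 := by
  rw [← profileAt_flow hs hst]
  exact antitone_profileAt hg hs (flow_nonneg hst le_rfl)

lemma profileAt_add_sqrt_le (hg : Profile B g) {M ρ : ℝ} (hs : 0 ≤ s) (hst : s ≤ t)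
    (hμ : ∀ u ∈ Icc s t, μ u ≤ M) (hρ : 0 ≤ ρ) :
    profileAt g μ t ((ρ + √(2 / 3 * M * (t - s))) ^ 3) ≤ profileAt g μ s (ρ ^ 3) := by
  rw [← profileAt_flow hs hst]
  exact antitone_profileAt hg hs (cube_le_flow hst hμ hρ)

lemma profileAt_add_cbrt_le (hg : Profile B g) {ρ : ℝ} (hs : 0 ≤ s) (hst : s ≤ t) (hρ : 0 ≤ ρ) :
    profileAt g μ s ((ρ + cbrt (t - s)) ^ 3) ≤ profileAt g μ t (ρ ^ 3) := by
  rw [← profileAt_flow hs hst]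
  refine antitone_profileAt hg hs ((flow_le_add hst _).trans ?_)
  have hcube := cbrt_pow_three (sub_nonneg.2 hst)
  have := cbrt_nonneg (t - s)
  have : 0 ≤ 3 * ρ * cbrt (t - s) * (ρ + cbrt (t - s)) := by positivity
  nlinarith

lemma integrableOn_profileAt_cube (hg : Profile B g) (ht : 0 ≤ t) :
    IntegrableOn (fun ρ => profileAt g μ t (ρ ^ 3)) (Ioi 0) := by
  obtain ⟨M, -, hμ⟩ := μ.exists_bound 0 t
  refine integrableOn_Ioi_of_comp_add_le (Real.sqrt_nonneg (2 / 3 * M * (t - 0)))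
    hg.integrableOn_cube (antitone_profileAt_cube hg ht) (fun _ => hg.nonneg _) fun x hx => ?_
  simpa using profileAt_add_sqrt_le hg le_rfl ht hμ hx

lemma radiusSum_le (hg : Profile B g) {M : ℝ} (hs : 0 ≤ s) (hst : s ≤ t)
    (hμ : ∀ u ∈ Icc s t, μ u ≤ M) :
    radiusSum g μ t ≤ radiusSum g μ s + √(2 / 3 * M * (t - s)) * profileAt g μ s 0 := by
  have hshift := setIntegral_Ioi_le_of_comp_add_le (Real.sqrt_nonneg (2 / 3 * M * (t - s)))
    (integrableOn_profileAt_cube hg hs) (antitone_profileAt_cube hg (hs.trans hst))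
    (fun _ => hg.nonneg _) fun x hx => profileAt_add_sqrt_le hg hs hst hμ hx
  rw [zero_pow three_ne_zero] at hshift
  exact hshift.trans (add_le_add_right (mul_le_mul_of_nonneg_left
    (profileAt_zero_le hg hs hst) (Real.sqrt_nonneg _)) _)

lemma radiusSum_le_add_cbrt (hg : Profile B g) (hs : 0 ≤ s) (hst : s ≤ t) :
    radiusSum g μ s ≤ radiusSum g μ t + cbrt (t - s) * profileAt g μ s 0 := by
  have hshift := setIntegral_Ioi_le_of_comp_add_le (cbrt_nonneg (t - s))
    (integrableOn_profileAt_cube hg (hs.trans hst)) (antitone_profileAt_cube hg hs)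
    (fun _ => hg.nonneg _) fun x hx => profileAt_add_cbrt_le (μ := μ) hg hs hst hx
  rwa [zero_pow three_ne_zero] at hshift

lemma abs_radiusSum_sub_le (hg : Profile B g) {M : ℝ} (hs : 0 ≤ s) (hst : s ≤ t)
    (hμ : ∀ u ∈ Icc s t, μ u ≤ M) :
    |radiusSum g μ t - radiusSum g μ s| ≤ (√(2 / 3 * M * (t - s)) + cbrt (t - s)) * g 0 := by
  have hmul : ∀ a, 0 ≤ a → a * profileAt g μ s 0 ≤ a * g 0 := fun a ha =>
    mul_le_mul_of_nonneg_left (hg.le_zero _) ha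
  have hsqrt := Real.sqrt_nonneg (2 / 3 * M * (t - s))
  have hcbrt := cbrt_nonneg (t - s)
  rw [abs_sub_le_iff, add_mul]
  constructor
  · linarith [radiusSum_le hg hs hst hμ, hmul _ hsqrt, mul_nonneg hcbrt (hg.nonneg 0)]
  · linarith [radiusSum_le_add_cbrt (μ := μ) hg hs hst, hmul _ hcbrt,
      mul_nonneg hsqrt (hg.nonneg 0)]

lemma abs_flow_zero_sub_le (hs : 0 ≤ s) (ht : 0 ≤ t) :
    |flow μ t 0 0 - flow μ s 0 0| ≤ |t - s| := by
  wlog hst : s ≤ t generalizing s t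
  · rw [abs_sub_comm, abs_sub_comm t]; exact this ht hs (le_of_not_ge hst)
  rw [← flow_flow hs hst]
  refine (abs_flow_sub_le hs _ _).trans ?_
  rw [sub_zero, abs_of_nonneg (flow_nonneg hst le_rfl), abs_of_nonneg (sub_nonneg.2 hst)]
  simpa using flow_le_add (μ := μ) hst 0

lemma integrableOn_profileAt (hg : Profile B g) (ht : 0 ≤ t) :
    IntegrableOn (profileAt g μ t) (Ioi 0) := by
  set p := flowSlope μ t 0 1
  have hscaled : IntegrableOn (fun x => g (p * x)) (Ioi 0) := by
    rw [integrableOn_Ioi_comp_mul_left_iff _ _ (flowSlope_pos _ _ _ _), mul_zero]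
    exact hg.integrable
  refine integrableOn_Ioi_of_comp_add_le zero_le_one hscaled
    (antitone_profileAt hg ht) (fun _ => hg.nonneg _) fun x hx => hg.antitone ?_
  have hchord := flow_add_flowSlope_mul_le (μ := μ) ht le_rfl zero_lt_one (le_add_of_nonneg_left hx)
  rw [add_sub_cancel_right] at hchord
  linarith [flow_nonneg (μ := μ) ht zero_le_one]

end Transport

section RateDependence

variable {B : ℝ} {g : ℝ → ℝ} {μ μ' : Rate} {t : ℝ}

lemma abs_flow_sub_flow_le (ht : 0 ≤ t) (x : ℝ) :
    |flow μ t x 0 - flow μ' t x 0| ≤ ∫ u in (0 : ℝ)..t, |μ u - μ' u| * cbrt (x + t) := by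
  have hle : ∀ μ μ' : Rate, flow μ t x 0 - flow μ' t x 0 ≤
      ∫ u in (0 : ℝ)..t, |μ u - μ' u| * cbrt (x + t) := fun μ μ' => by
    have h := (isTrajectory_flow (μ := μ) (x := x)).sub_le (isTrajectory_flow (μ := μ') (x := x))
      continuous_flow ht
    rw [flow_self, flow_self, sub_self, max_self, zero_add] at h
    refine h.trans (intervalIntegral.integral_mono_on ht
      (Continuous.intervalIntegrable (by fun_prop) _ _)
      (Continuous.intervalIntegrable (by fun_prop) _ _) fun u hu => ?_)
    refine mul_le_mul_of_nonneg_left (monotone_cbrt ?_) (abs_nonneg _)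
    linarith [flow_le_add (μ := μ') hu.2 x, hu.1]
  refine abs_sub_le_iff.2 ⟨hle μ μ', ?_⟩
  simpa only [abs_sub_comm (μ' _)] using hle μ' μ

lemma flow_congr (ht : 0 ≤ t) (h : ∀ u ∈ Ioo 0 t, μ u = μ' u) (x : ℝ) :
    flow μ t x 0 = flow μ' t x 0 := by
  have hint : ∫ u in (0 : ℝ)..t, |μ u - μ' u| * cbrt (x + t) = ∫ _ in (0 : ℝ)..t, (0 : ℝ) :=
    intervalIntegral.integral_congr_Ioo_of_le ht fun u hu => by simp [h u hu]
  have hle := abs_flow_sub_flow_le (μ := μ) (μ' := μ') ht x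
  rw [hint, intervalIntegral.integral_zero] at hle
  exact sub_eq_zero.1 (abs_nonpos_iff.1 hle)

lemma radiusSum_congr (ht : 0 ≤ t) (h : ∀ u ∈ Ioo 0 t, μ u = μ' u) :
    radiusSum g μ t = radiusSum g μ' t := by
  simp only [radiusSum, profileAt, flow_congr ht h]

variable {ι : Type*} {l : Filter ι} [l.NeBot] [l.IsCountablyGenerated] {ν : ι → Rate} {M : ℝ}

lemma tendsto_flow (ht : 0 ≤ t) (hM : ∀ n, ∀ u ∈ Icc 0 t, ν n u ≤ M)
    (h : ∀ u ∈ Icc 0 t, Tendsto (fun n => ν n u) l (𝓝 (μ u))) (x : ℝ) :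
    Tendsto (fun n => flow (ν n) t x 0) l (𝓝 (flow μ t x 0)) := by
  have hint : Tendsto (fun n => ∫ u in (0 : ℝ)..t, |ν n u - μ u| * cbrt (x + t)) l
      (𝓝 (∫ _ in (0 : ℝ)..t, (0 : ℝ))) := by
    refine intervalIntegral.tendsto_integral_filter_of_dominated_convergence
      (fun _ => M * cbrt (x + t))
      (Eventually.of_forall fun n => Continuous.aestronglyMeasurable (by fun_prop))
      (Eventually.of_forall fun n => Eventually.of_forall fun u hu => ?_)
      intervalIntegrable_const (Eventually.of_forall fun u hu => ?_)
    all_goals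
      rw [uIoc_of_le ht] at hu
      have hu' := Ioc_subset_Icc_self hu
    · rw [Real.norm_of_nonneg (mul_nonneg (abs_nonneg _) (cbrt_nonneg _))]
      refine mul_le_mul_of_nonneg_right (abs_sub_le_iff.2 ⟨?_, ?_⟩) (cbrt_nonneg _)
      · linarith [hM n u hu', μ.nonneg u]
      · linarith [le_of_tendsto' (h u hu') fun n => hM n u hu', (ν n).nonneg u]
    · simpa using ((h u hu').sub_const (μ u)).abs.mul_const (cbrt (x + t))
  rw [intervalIntegral.integral_zero] at hint
  rw [tendsto_iff_dist_tendsto_zero]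
  exact squeeze_zero (fun _ => dist_nonneg) (fun n => abs_flow_sub_flow_le ht x) hint

lemma ae_continuousAt_flow_cube (hg : Profile B g) (ht : 0 ≤ t) :
    ∀ᵐ ρ ∂volume.restrict (Ioi (0 : ℝ)), ContinuousAt g (flow μ t (ρ ^ 3) 0) := by
  have hinj : InjOn (fun ρ : ℝ => flow μ t (ρ ^ 3) 0) (Ioi 0) :=
    StrictMonoOn.injOn fun ρ hρ σ _ h => flow_zero_lt ht (pow_nonneg (le_of_lt hρ) 3)
      (pow_lt_pow_left₀ h (le_of_lt hρ) three_ne_zero)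
  have hcount : {ρ : ℝ | ρ ∈ Ioi 0 ∧ ¬ ContinuousAt g (flow μ t (ρ ^ 3) 0)}.Countable :=
    MapsTo.countable_of_injOn (fun ρ hρ => hρ.2) (hinj.mono fun ρ hρ => hρ.1)
      hg.antitone.countable_not_continuousAt
  rw [ae_restrict_iff' measurableSet_Ioi]
  filter_upwards [hcount.ae_notMem volume] with ρ hρ hρ0
  exact not_not.1 fun hc => hρ ⟨hρ0, hc⟩

lemma profileAt_cube_le (hg : Profile B g) (ht : 0 ≤ t) (hμ : ∀ u ∈ Icc 0 t, μ u ≤ M) (ρ : ℝ) :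
    profileAt g μ t (ρ ^ 3) ≤ g (max (ρ - √(2 / 3 * M * (t - 0))) 0 ^ 3) := by
  set a := √(2 / 3 * M * (t - 0))
  rcases le_total ρ a with hρ | hρ
  · rw [max_eq_right (sub_nonpos.2 hρ), zero_pow three_ne_zero]
    exact hg.le_zero _
  · rw [max_eq_left (sub_nonneg.2 hρ)]
    have h := profileAt_add_sqrt_le hg le_rfl ht hμ (sub_nonneg.2 hρ)
    rwa [profileAt_time_zero, sub_add_cancel] at h

lemma tendsto_radiusSum (hg : Profile B g) (ht : 0 ≤ t) (hM : ∀ n, ∀ u ∈ Icc 0 t, ν n u ≤ M)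
    (h : ∀ u ∈ Icc 0 t, Tendsto (fun n => ν n u) l (𝓝 (μ u))) :
    Tendsto (fun n => radiusSum g (ν n) t) l (𝓝 (radiusSum g μ t)) := by
  set a := √(2 / 3 * M * (t - 0))
  have hG : Antitone fun ρ => g (max (ρ - a) 0 ^ 3) := hg.antitone.comp_monotone fun x y hxy =>
    pow_le_pow_left₀ (le_max_right _ _) (max_le_max_right _ (by linarith)) 3
  refine tendsto_integral_filter_of_dominated_convergence (fun ρ => g (max (ρ - a) 0 ^ 3))
    (Eventually.of_forall fun n =>
      (antitone_profileAt_cube hg ht).measurable.aestronglyMeasurable)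
    (Eventually.of_forall fun n => Eventually.of_forall fun ρ => ?_)
    (integrableOn_Ioi_of_comp_add_le (b := a) (Real.sqrt_nonneg _) hg.integrableOn_cube hG
      (fun _ => hg.nonneg _) fun x hx => ?_) ?_
  · rw [Real.norm_of_nonneg (profileAt_nonneg hg _)]
    exact profileAt_cube_le hg ht (hM n) ρ
  · rw [add_sub_cancel_right, max_eq_left hx]
  · filter_upwards [ae_continuousAt_flow_cube hg ht] with ρ hρ
    exact hρ.tendsto.comp (tendsto_flow ht hM h _)

end RateDependence

/-- The pair of quantities at time `t` that determines the rate at that time: the initial position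
of the characteristic that reaches `0`, and the integral `radiusSum`. -/
def state (g : ℝ → ℝ) (μ : Rate) (t : ℝ) : ℝ × ℝ := (flow μ t 0 0, radiusSum g μ t)

section State

variable {B : ℝ} {g : ℝ → ℝ} {μ : Rate} {s t : ℝ}

@[simp]
lemma state_time_zero : state g μ 0 = (0, ∫ ρ in Ioi 0, g (ρ ^ 3)) := by
  simp [state, radiusSum]

lemma dist_state_le (hg : Profile B g) {M : ℝ} (hs : 0 ≤ s) (hst : s ≤ t)
    (hμ : ∀ u ∈ Icc s t, μ u ≤ M) :
    dist (state g μ t) (state g μ s) ≤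
      |t - s| + (√(2 / 3 * M * |t - s|) + cbrt |t - s|) * g 0 := by
  have hpos : 0 ≤ (√(2 / 3 * M * |t - s|) + cbrt |t - s|) * g 0 :=
    mul_nonneg (add_nonneg (Real.sqrt_nonneg _) (cbrt_nonneg _)) (hg.nonneg 0)
  have hflow := abs_flow_zero_sub_le (μ := μ) hs (hs.trans hst)
  have hsum := abs_radiusSum_sub_le hg hs hst hμ
  rw [← abs_of_nonneg (sub_nonneg.2 hst)] at hsum
  exact max_le (hflow.trans (le_add_of_nonneg_right hpos))
    (hsum.trans (le_add_of_nonneg_left (abs_nonneg _)))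

lemma equicontinuous_state (hg : Profile B g) {ι : Type*} {ν : ι → Rate}
    (hν : ∀ T, ∃ M, ∀ i, ∀ u ∈ Icc 0 T, ν i u ≤ M) :
    Equicontinuous fun i t => state g (ν i) (max t 0) := by
  intro t
  obtain ⟨M, hM⟩ := hν (max (t + 1) 0)
  refine Metric.equicontinuousAt_of_continuity_modulus
    (fun s => |max s 0 - max t 0| +
      (√(2 / 3 * M * |max s 0 - max t 0|) + cbrt |max s 0 - max t 0|) * g 0) ?_ _ ?_
  · exact (Continuous.tendsto (by fun_prop) t).trans (by simp [cbrt_of_nonpos le_rfl])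
  filter_upwards [eventually_le_nhds (lt_add_one t)] with s hs i
  have hmax : ∀ {r}, r ≤ t + 1 → max r 0 ≤ max (t + 1) 0 := max_le_max_right 0
  rcases le_total s t with h | h
  · rw [abs_sub_comm]
    exact dist_state_le hg (le_max_right _ _) (max_le_max_right 0 h) fun u hu =>
      hM i u ⟨(le_max_right _ _).trans hu.1, hu.2.trans (hmax (lt_add_one t).le)⟩
  · rw [dist_comm]
    exact dist_state_le hg (le_max_right _ _) (max_le_max_right 0 h) fun u hu =>
      hM i u ⟨(le_max_right _ _).trans hu.1, hu.2.trans (hmax hs)⟩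

lemma continuous_state (hg : Profile B g) (μ : Rate) :
    Continuous fun t => state g μ (max t 0) :=
  (equicontinuous_state hg (ν := fun _ : Unit => μ) fun T =>
    let ⟨M, _, hM⟩ := μ.exists_bound 0 T; ⟨M, fun _ => hM⟩).continuous ()

lemma continuousOn_state (hg : Profile B g) (μ : Rate) : ContinuousOn (state g μ) (Ici 0) :=
  (continuous_state hg μ).continuousOn.congr fun t ht => by
    simp only [max_eq_left (mem_Ici.1 ht)]

lemma continuousOn_flow_zero (hg : Profile B g) (μ : Rate) :
    ContinuousOn (fun t => flow μ t 0 0) (Ici 0) :=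
  continuous_fst.comp_continuousOn (continuousOn_state hg μ)

lemma continuousOn_radiusSum (hg : Profile B g) (μ : Rate) :
    ContinuousOn (radiusSum g μ) (Ici 0) :=
  continuous_snd.comp_continuousOn (continuousOn_state hg μ)

lemma state_congr {μ' : Rate} (ht : 0 ≤ t) (h : ∀ u ∈ Ioo 0 t, μ u = μ' u) :
    state g μ t = state g μ' t := by
  rw [state, state, flow_congr ht h, radiusSum_congr ht h]

lemma tendsto_state (hg : Profile B g) {ι : Type*} {l : Filter ι} [l.NeBot]
    [l.IsCountablyGenerated] {ν : ι → Rate} {M : ℝ} (ht : 0 ≤ t)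
    (hM : ∀ n, ∀ u ∈ Icc 0 t, ν n u ≤ M)
    (h : ∀ u ∈ Icc 0 t, Tendsto (fun n => ν n u) l (𝓝 (μ u))) :
    Tendsto (fun n => state g (ν n) t) l (𝓝 (state g μ t)) :=
  (tendsto_flow ht hM h 0).prodMk_nhds (tendsto_radiusSum hg ht hM h)

lemma exists_rate_eq_comp_state (hg : Profile B g) {R : C(ℝ × ℝ × ℝ, ℝ)} (hR0 : ∀ p, 0 ≤ R p)
    {M : ℝ → ℝ} (hM : Monotone M) (hR : ∀ t p, R (t, p) ≤ M t) :
    ∃ μ : Rate, ∀ t ≥ 0, μ t = R (t, state g μ t) := by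
  let ν : C(ℝ, ℝ × ℝ) → Rate := fun v => ⟨fun t => R (t, v t), by fun_prop, fun t => hR0 _⟩
  have hν : ∀ T v, ∀ u ∈ Icc 0 T, ν v u ≤ M T := fun T v u hu => (hR u _).trans (hM hu.2)
  let Φ : C(ℝ, ℝ × ℝ) → C(ℝ, ℝ × ℝ) := fun v =>
    ⟨fun t => state g (ν v) (max t 0), continuous_state hg (ν v)⟩
  obtain ⟨v, hv⟩ : ∃ v, Φ v = v := by
    refine exists_fixedPoint_of_causal (fun t => ?_) (fun v v' t h => ?_)
      (equicontinuous_state hg fun T => ⟨M T, hν T⟩) fun t => ?_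
    · refine continuous_iff_continuousAt.2 fun v =>
        tendsto_state hg (le_max_right t 0) (hν _) fun u _ => ?_
      exact (R.continuous.comp (continuous_const.prodMk
        (continuous_eval_const u))).tendsto v
    · refine state_congr (le_max_right t 0) fun u hu => ?_
      have hut : u < t := (lt_max_iff.1 hu.2).resolve_right hu.1.not_gt
      exact congrArg (fun y => R (u, y)) (h u ⟨hu.1.le, hut⟩)
    · refine ⟨_, isCompact_closedBall (0, ∫ ρ in Ioi 0, g (ρ ^ 3))
        (|max t 0 - 0| + (√(2 / 3 * M (max t 0) * |max t 0 - 0|) + cbrt |max t 0 - 0|) * g 0),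
        fun v => ?_⟩
      have hdist := dist_state_le hg le_rfl (le_max_right t 0) (hν _ v)
      rwa [state_time_zero] at hdist
  refine ⟨ν v, fun t ht => ?_⟩
  have hvt : state g (ν v) (max t 0) = v t := DFunLike.congr_fun hv t
  rw [max_eq_left ht] at hvt
  rw [hvt]

end State

lemma Profile.continuous_min_mul_tail {B : ℝ} {g : ℝ → ℝ} (hg : Profile B g) :
    Continuous fun p : ℝ × ℝ => min (g p.2) (p.1 * tail g p.2) := by
  have htail : Continuous fun p : ℝ × ℝ => p.1 * tail g p.2 :=
    continuous_fst.mul (hg.continuous_tail.comp continuous_snd)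
  refine continuous_iff_continuousAt.2 fun ⟨k, x⟩ => ?_
  rcases (hg.nonneg x).eq_or_lt with h0 | hpos
  · have hupper := htail.tendsto (k, x)
    have hlower := (continuous_const (y := (0 : ℝ)).min htail).tendsto (k, x)
    simp only [hg.tail_eq_zero h0.symm, mul_zero, min_self] at hupper hlower
    simp only [ContinuousAt, ← h0, hg.tail_eq_zero h0.symm, mul_zero, min_self]
    exact tendsto_of_tendsto_of_tendsto_of_le_of_le hlower hupper
      (fun p => min_le_min_right _ (hg.nonneg _)) fun p => min_le_right _ _
  · exact ((hg.continuousAt x hpos).comp continuousAt_snd).min htail.continuousAt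

/-- The right side `w(0,t) / (1/3 ∫ x^{-2/3} w(x,t) dx)` of the relation that determines the rate,
with numerator and denominator replaced by `min (w(0,t)) (K t h₀)` and `max (·) (c t)`; this makes
it continuous even where `g` jumps to zero. -/
def response (g K c : ℝ → ℝ) (t : ℝ) (p : ℝ × ℝ) : ℝ :=
  min (g p.1) (K t * tail g p.1) / max p.2 (c t)

lemma exists_rate_eq_response {B : ℝ} {g K c : ℝ → ℝ} (hg : Profile B g) (hK : Continuous K)
    (hK0 : ∀ t, 0 ≤ K t) (hc : Continuous c) (hc0 : ∀ t, 0 < c t) (hca : Antitone c) :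
    ∃ μ : Rate, ∀ t ≥ 0, μ t = response g K c t (state g μ t) := by
  have hmax : ∀ t v, 0 < max v (c t) := fun t v => (hc0 t).trans_le (le_max_right _ _)
  let R : C(ℝ × ℝ × ℝ, ℝ) :=
    { toFun := fun p => response g K c p.1 p.2
      continuous_toFun := (hg.continuous_min_mul_tail.comp
        (f := fun p : ℝ × ℝ × ℝ => (K p.1, p.2.1)) (by fun_prop)).div (by fun_prop)
        fun p => (hmax _ _).ne' }
  refine exists_rate_eq_comp_state hg (R := R) (M := fun t => g 0 / c t) (fun p => ?_)
    (fun s t hst => div_le_div_of_nonneg_left (hg.nonneg 0) (hc0 t) (hca hst)) fun t p => ?_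
  · exact div_nonneg (le_min (hg.nonneg _) (mul_nonneg (hK0 _) (hg.tail_nonneg _))) (hmax _ _).le
  · exact div_le_div₀ (hg.nonneg 0) ((min_le_left _ _).trans (hg.le_zero _)) (hc0 t)
      (le_max_right _ _)

/-! ### Conservation of mass -/

section ForwardPath

variable {μ : Rate} {T s x ξ : ℝ} (hT : 0 ≤ T)

/-- The trajectory on `[0,T]` that starts at `ξ`, extended by a constant after the time `T` to
make it jointly measurable in time and starting point. -/
def forwardPath (μ : Rate) (hT : 0 ≤ T) (s ξ : ℝ) : ℝ :=
  flow μ T (Function.surjInv (surjective_flow (μ := μ) hT) ξ) (min s T)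

lemma flow_forwardPath (hs : s ∈ Icc 0 T) (ξ : ℝ) : flow μ s (forwardPath μ hT s ξ) 0 = ξ := by
  rw [forwardPath, min_eq_left hs.2, flow_flow hs.1 hs.2]
  exact Function.surjInv_eq (surjective_flow hT) ξ

lemma forwardPath_time_zero (ξ : ℝ) : forwardPath μ hT 0 ξ = ξ := by
  simpa using flow_forwardPath (μ := μ) hT (left_mem_Icc.2 hT) ξ

lemma lt_forwardPath_iff (hs : s ∈ Icc 0 T) (hx : 0 ≤ x) :
    x < forwardPath μ hT s ξ ↔ flow μ s x 0 < ξ := by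
  refine ⟨fun h => ?_, fun h => ?_⟩
  · simpa only [flow_forwardPath hT hs] using flow_zero_lt (μ := μ) hs.1 hx h
  · refine (flow_mono (μ := μ) hs.1).reflect_lt ?_
    simpa only [flow_forwardPath hT hs] using h

lemma continuous_forwardPath (ξ : ℝ) : Continuous fun s => forwardPath μ hT s ξ :=
  continuous_flow.comp (by fun_prop)

lemma monotone_forwardPath (s : ℝ) : Monotone (forwardPath μ hT s) := by
  refine (flow_mono (min_le_right s T)).comp fun ξ η h => ?_
  rcases h.eq_or_lt with rfl | h
  · rfl
  refine ((flow_mono (μ := μ) hT).reflect_lt ?_).le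
  simpa only [Function.surjInv_eq (surjective_flow (μ := μ) hT)] using h

lemma measurable_forwardPath : Measurable (Function.uncurry (forwardPath μ hT)) :=
  measurable_uncurry_of_continuous_of_measurable (continuous_forwardPath hT)
    fun s => (monotone_forwardPath hT s).measurable

lemma hasDerivAt_forwardPath (hs : s < T) :
    HasDerivAt (fun s => forwardPath μ hT s ξ) (-1 + μ s * cbrt (forwardPath μ hT s ξ)) s := by
  rw [forwardPath, min_eq_left hs.le]
  refine (isTrajectory_flow s hs.le).congr_of_eventuallyEq ?_
  filter_upwards [Iio_mem_nhds hs] with u hu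
  rw [forwardPath, min_eq_left (mem_Iio.1 hu).le]

lemma hasDerivWithinAt_max_zero {X : ℝ → ℝ} {a : ℝ} (hX : HasDerivAt X a s)
    (ha : X s = 0 → a < 0) :
    HasDerivWithinAt (fun s => max (X s) 0) (if 0 < X s then a else 0) (Ioi s) s := by
  rcases lt_trichotomy (X s) 0 with h | h | h
  · rw [if_neg h.not_gt]
    refine ((hasDerivAt_const s (0 : ℝ)).congr_of_eventuallyEq ?_).hasDerivWithinAt
    filter_upwards [hX.continuousAt.eventually (gt_mem_nhds h)] with u hu
    exact max_eq_right hu.le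
  · rw [if_neg h.not_gt]
    refine (hasDerivWithinAt_const s (Ioi s) (0 : ℝ)).congr_of_eventuallyEq ?_ (by simp [h])
    have hslope := (hasDerivAt_iff_tendsto_slope.1 hX).mono_left
      (nhdsWithin_mono s fun _ (hu : _ ∈ Ioi s) => hu.ne')
    filter_upwards [hslope.eventually (gt_mem_nhds (ha h)), self_mem_nhdsWithin] with u hu hus
    rw [slope_def_field, h, sub_zero, div_lt_iff₀ (sub_pos.2 hus), zero_mul] at hu
    exact max_eq_right hu.le
  · rw [if_pos h]
    refine (hX.congr_of_eventuallyEq ?_).hasDerivWithinAt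
    filter_upwards [hX.continuousAt.eventually (lt_mem_nhds h)] with u hu
    exact max_eq_left hu.le

lemma integrableOn_indicator_forwardPath (ξ : ℝ) :
    IntegrableOn ({s | 0 < forwardPath μ hT s ξ}.indicator (1 : ℝ → ℝ)) (Ioc 0 T) :=
  (integrable_const (1 : ℝ)).indicator
    (isOpen_lt continuous_const (continuous_forwardPath hT ξ)).measurableSet

lemma integrableOn_mul_cbrt_forwardPath (ξ : ℝ) :
    IntegrableOn (fun s => μ s * cbrt (forwardPath μ hT s ξ)) (Ioc 0 T) :=
  (μ.continuous.mul (continuous_cbrt.comp (continuous_forwardPath hT ξ))).integrableOn_Ioc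

-- A positive size shrinks at rate `1 - μ x^{1/3}` until it reaches `0`, where it is removed.
lemma forwardPath_balance (hξ : 0 ≤ ξ) :
    max (forwardPath μ hT T ξ) 0 +
        ∫ s in Ioc 0 T, {s | 0 < forwardPath μ hT s ξ}.indicator (1 : ℝ → ℝ) s =
      ξ + ∫ s in Ioc 0 T, μ s * cbrt (forwardPath μ hT s ξ) := by
  set X := fun s => forwardPath μ hT s ξ
  have hgrowth : IntervalIntegrable (fun s => μ s * cbrt (X s)) volume 0 T :=
    (intervalIntegrable_iff_integrableOn_Ioc_of_le hT).2 (integrableOn_mul_cbrt_forwardPath hT ξ)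
  have hlife : IntervalIntegrable ({s | 0 < X s}.indicator (1 : ℝ → ℝ)) volume 0 T :=
    (intervalIntegrable_iff_integrableOn_Ioc_of_le hT).2 (integrableOn_indicator_forwardPath hT ξ)
  have hftc : ∫ s in (0 : ℝ)..T, (μ s * cbrt (X s) - {s | 0 < X s}.indicator (1 : ℝ → ℝ) s) =
      max (X T) 0 - max (X 0) 0 := by
    refine intervalIntegral.integral_eq_sub_of_hasDeriv_right_of_le hT
      ((continuous_forwardPath hT ξ).max continuous_const).continuousOn (fun s hs => ?_)
      (hgrowth.sub hlife)
    have hderiv := hasDerivWithinAt_max_zero (hasDerivAt_forwardPath (μ := μ) (ξ := ξ) hT hs.2)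
      fun h => by rw [h, cbrt_of_nonpos le_rfl]; norm_num
    refine hderiv.congr_deriv ?_
    by_cases h : 0 < X s
    · rw [indicator_of_mem (by exact h), if_pos h, Pi.one_apply]
      ring
    · rw [indicator_of_notMem (by exact h), if_neg h, cbrt_of_nonpos (not_lt.1 h)]
      ring
  rw [intervalIntegral.integral_sub hgrowth hlife, show X 0 = ξ from forwardPath_time_zero hT ξ,
    max_eq_left hξ,
    intervalIntegral.integral_of_le hT, intervalIntegral.integral_of_le hT] at hftc
  linarith

lemma ofReal_forwardPath_balance (hξ : 0 ≤ ξ) :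
    ENNReal.ofReal (max (forwardPath μ hT T ξ) 0) +
        ∫⁻ s in Ioc 0 T, {s | 0 < forwardPath μ hT s ξ}.indicator 1 s =
      ENNReal.ofReal ξ + ∫⁻ s in Ioc 0 T, ENNReal.ofReal (μ s * cbrt (forwardPath μ hT s ξ)) := by
  have hlife0 : ∀ s, 0 ≤ {s | 0 < forwardPath μ hT s ξ}.indicator (1 : ℝ → ℝ) s :=
    indicator_nonneg fun _ _ => zero_le_one
  have hgrowth0 : ∀ s, 0 ≤ μ s * cbrt (forwardPath μ hT s ξ) := fun s =>
    mul_nonneg (μ.nonneg s) (cbrt_nonneg _)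
  have hlife : ∫⁻ s in Ioc 0 T, {s | 0 < forwardPath μ hT s ξ}.indicator 1 s = ENNReal.ofReal
      (∫ s in Ioc 0 T, {s | 0 < forwardPath μ hT s ξ}.indicator (1 : ℝ → ℝ) s) := by
    rw [ofReal_integral_eq_lintegral_ofReal (integrableOn_indicator_forwardPath hT ξ)
      (Eventually.of_forall hlife0)]
    refine lintegral_congr fun s => ?_
    by_cases h : s ∈ {s | 0 < forwardPath μ hT s ξ} <;> simp [h]
  rw [hlife, ← ofReal_integral_eq_lintegral_ofReal (integrableOn_mul_cbrt_forwardPath hT ξ)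
    (Eventually.of_forall hgrowth0), ← ENNReal.ofReal_add (le_max_right _ _)
    (integral_nonneg hlife0), ← ENNReal.ofReal_add hξ (integral_nonneg hgrowth0),
    forwardPath_balance hT hξ]

end ForwardPath

lemma Profile.tendsto_zero {B : ℝ} {g : ℝ → ℝ} (hg : Profile B g) : Tendsto g atTop (𝓝 0) := by
  refine squeeze_zero' (Eventually.of_forall hg.nonneg) (g := fun x => 1 / x) ?_ ?_
  · filter_upwards [eventually_gt_atTop 0] with x hx
    have h := hg.mul_le_tail_sub_tail hx.le
    rw [hg.tail_zero, sub_zero] at h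
    rw [le_div_iff₀ hx]
    linarith [hg.tail_nonneg x]
  · simpa using tendsto_inv_atTop_zero (𝕜 := ℝ)

/-- The size distribution on `(0,∞)` whose complementary distribution function is `g`. -/
def sizeMeasure {B : ℝ} {g : ℝ → ℝ} (hg : Profile B g) : Measure ℝ :=
  (StieltjesFunction.mk (fun x => -g x) (fun _ _ h => neg_le_neg (hg.antitone h))
    fun x => (hg.rightCont x).neg).measure.restrict (Ioi 0)

section MassBalance

variable {B : ℝ} {g : ℝ → ℝ} {μ : Rate} {T s x : ℝ}

instance (hg : Profile B g) : SFinite (sizeMeasure hg) := by unfold sizeMeasure; infer_instance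

lemma sizeMeasure_Ioi (hg : Profile B g) (hx : 0 ≤ x) :
    sizeMeasure hg (Ioi x) = ENNReal.ofReal (g x) := by
  rw [sizeMeasure, Measure.restrict_apply measurableSet_Ioi,
    inter_eq_left.2 (Ioi_subset_Ioi hx), StieltjesFunction.measure_Ioi _ (l := 0)]
  · simp
  · simpa using hg.tendsto_zero.neg

lemma ae_sizeMeasure_pos (hg : Profile B g) : ∀ᵐ ξ ∂sizeMeasure hg, 0 < ξ :=
  ae_restrict_mem measurableSet_Ioi

lemma sizeMeasure_lt_forwardPath (hT : 0 ≤ T) (hg : Profile B g) (hs : s ∈ Icc 0 T)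
    (hx : 0 ≤ x) :
    sizeMeasure hg {ξ | x < forwardPath μ hT s ξ} = ENNReal.ofReal (profileAt g μ s x) := by
  simp only [lt_forwardPath_iff hT hs hx]
  exact sizeMeasure_Ioi hg (flow_nonneg hs.1 hx)

lemma lintegral_forwardPath (hT : 0 ≤ T) (hg : Profile B g) (hs : s ∈ Icc 0 T) :
    ∫⁻ ξ, ENNReal.ofReal (max (forwardPath μ hT s ξ) 0) ∂sizeMeasure hg =
      ∫⁻ x in Ioi 0, ENNReal.ofReal (profileAt g μ s x) := by
  rw [lintegral_eq_lintegral_meas_lt (f := fun ξ => max (forwardPath μ hT s ξ) 0) _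
    (Eventually.of_forall fun _ => le_max_right _ _)
    ((monotone_forwardPath hT s).measurable.max measurable_const).aemeasurable]
  refine setLIntegral_congr_fun measurableSet_Ioi fun x (hx : 0 < x) => ?_
  simp only [lt_max_iff, hx.not_gt, or_false]
  exact sizeMeasure_lt_forwardPath hT hg hs hx.le

lemma lintegral_cbrt_forwardPath (hT : 0 ≤ T) (hg : Profile B g) (hs : s ∈ Icc 0 T) :
    ∫⁻ ξ, ENNReal.ofReal (cbrt (forwardPath μ hT s ξ)) ∂sizeMeasure hg =
      ENNReal.ofReal (radiusSum g μ s) := by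
  rw [lintegral_eq_lintegral_meas_lt _ (Eventually.of_forall fun _ => cbrt_nonneg _)
    (continuous_cbrt.measurable.comp (monotone_forwardPath hT s).measurable).aemeasurable,
    radiusSum, ofReal_integral_eq_lintegral_ofReal (integrableOn_profileAt_cube hg hs.1)
      (Eventually.of_forall fun _ => hg.nonneg _)]
  refine setLIntegral_congr_fun measurableSet_Ioi fun x (hx : 0 < x) => ?_
  simp only [lt_cbrt_iff hx.le]
  exact sizeMeasure_lt_forwardPath hT hg hs (by positivity)

lemma lintegral_sizeMeasure (hg : Profile B g) :
    ∫⁻ ξ, ENNReal.ofReal ξ ∂sizeMeasure hg = 1 := by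
  have h := lintegral_forwardPath (μ := ⟨0, continuous_zero, fun _ => le_rfl⟩) le_rfl hg
    (left_mem_Icc.2 le_rfl)
  simp only [forwardPath_time_zero, profileAt_time_zero] at h
  rw [← ofReal_integral_eq_lintegral_ofReal hg.integrable (Eventually.of_forall hg.nonneg),
    hg.integral_eq_one, ENNReal.ofReal_one] at h
  rw [← h]
  refine lintegral_congr_ae ((ae_sizeMeasure_pos hg).mono fun ξ hξ => ?_)
  simp only [max_eq_left hξ.le]

lemma lintegral_lifetime (hT : 0 ≤ T) (hg : Profile B g) :
    ∫⁻ ξ, (∫⁻ s in Ioc 0 T, {s | 0 < forwardPath μ hT s ξ}.indicator 1 s) ∂sizeMeasure hg =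
      ∫⁻ s in Ioc 0 T, ENNReal.ofReal (profileAt g μ s 0) := by
  have hmeas : Measurable (Function.uncurry fun ξ s =>
      {s | 0 < forwardPath μ hT s ξ}.indicator (1 : ℝ → ENNReal) s) :=
    (measurable_one.indicator (measurableSet_Ioi (a := (0 : ℝ)))).comp
      ((measurable_forwardPath hT).comp measurable_swap)
  rw [lintegral_lintegral_swap hmeas.aemeasurable]
  refine setLIntegral_congr_fun measurableSet_Ioc fun s hs => ?_
  rw [← sizeMeasure_lt_forwardPath hT hg (Ioc_subset_Icc_self hs) le_rfl, ← lintegral_indicator_one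
    (measurableSet_lt measurable_const (monotone_forwardPath hT s).measurable)]
  rfl

lemma lintegral_growth (hT : 0 ≤ T) (hg : Profile B g) :
    ∫⁻ ξ, (∫⁻ s in Ioc 0 T, ENNReal.ofReal (μ s * cbrt (forwardPath μ hT s ξ))) ∂sizeMeasure hg =
      ∫⁻ s in Ioc 0 T, ENNReal.ofReal (μ s * radiusSum g μ s) := by
  have hmeas : Measurable (Function.uncurry fun ξ s =>
      ENNReal.ofReal (μ s * cbrt (forwardPath μ hT s ξ))) :=
    ((μ.continuous.measurable.comp measurable_snd).mul (continuous_cbrt.measurable.comp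
      ((measurable_forwardPath hT).comp measurable_swap))).ennreal_ofReal
  rw [lintegral_lintegral_swap hmeas.aemeasurable]
  refine setLIntegral_congr_fun measurableSet_Ioc fun s hs => ?_
  simp only [ENNReal.ofReal_mul (μ.nonneg s)]
  rw [lintegral_const_mul (f := fun ξ => ENNReal.ofReal (cbrt (forwardPath μ hT s ξ))) _
    (continuous_cbrt.measurable.comp (monotone_forwardPath hT s).measurable).ennreal_ofReal,
    lintegral_cbrt_forwardPath hT hg (Ioc_subset_Icc_self hs)]

lemma mass_balance (hT : 0 ≤ T) (μ : Rate) (hg : Profile B g) :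
    (∫⁻ x in Ioi 0, ENNReal.ofReal (profileAt g μ T x)) +
        ∫⁻ s in Ioc 0 T, ENNReal.ofReal (profileAt g μ s 0) =
      1 + ∫⁻ s in Ioc 0 T, ENNReal.ofReal (μ s * radiusSum g μ s) := by
  rw [← lintegral_forwardPath hT hg (right_mem_Icc.2 hT), ← lintegral_lifetime hT hg,
    ← lintegral_growth hT hg, ← lintegral_sizeMeasure hg,
    ← lintegral_add_left ((monotone_forwardPath hT T).measurable.max
      measurable_const).ennreal_ofReal, ← lintegral_add_left ENNReal.measurable_ofReal]
  exact lintegral_congr_ae ((ae_sizeMeasure_pos hg).mono fun ξ hξ =>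
    ofReal_forwardPath_balance hT hξ.le)

lemma integral_profileAt_eq_one (hg : Profile B g) (hT : 0 ≤ T)
    (h : ∀ s ∈ Ico 0 T, μ s * radiusSum g μ s = profileAt g μ s 0) :
    ∫ x in Ioi 0, profileAt g μ T x = 1 := by
  have hbalance := mass_balance hT μ hg
  have hrates : ∫⁻ s in Ioc 0 T, ENNReal.ofReal (μ s * radiusSum g μ s) =
      ∫⁻ s in Ioc 0 T, ENNReal.ofReal (profileAt g μ s 0) := by
    rw [← restrict_Ico_eq_restrict_Ioc]
    exact setLIntegral_congr_fun measurableSet_Ico fun s hs => by rw [h s hs]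
  have hfin : ∫⁻ s in Ioc 0 T, ENNReal.ofReal (profileAt g μ s 0) ≠ ⊤ := by
    refine ne_top_of_le_ne_top (b := ∫⁻ _ in Ioc 0 T, ENNReal.ofReal (g 0)) ?_
      (lintegral_mono fun s => ENNReal.ofReal_le_ofReal (hg.le_zero _))
    rw [setLIntegral_const]
    exact ENNReal.mul_ne_top ENNReal.ofReal_ne_top (by simp)
  rwa [hrates, ENNReal.add_left_inj hfin, ← ofReal_integral_eq_lintegral_ofReal
    (integrableOn_profileAt hg hT) (Eventually.of_forall fun _ => hg.nonneg _),
    ENNReal.ofReal_eq_one] at hbalance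

end MassBalance

/-! ### A priori bounds -/

lemma mul_le_integral_Ioi_of_antitone {f : ℝ → ℝ} {y : ℝ} (hf : Antitone f) (hf0 : ∀ x, 0 ≤ f x)
    (hfi : IntegrableOn f (Ioi 0)) (hy : 0 ≤ y) : y * f y ≤ ∫ x in Ioi 0, f x :=
  calc y * f y = ∫ _ in Ioc 0 y, f y := by simp [hy]
    _ ≤ ∫ x in Ioc 0 y, f x := setIntegral_mono_on (by simp) (hfi.mono_set Ioc_subset_Ioi_self)
      measurableSet_Ioc fun _ hx => hf hx.2
    _ ≤ ∫ x in Ioi 0, f x := setIntegral_mono_set hfi (Eventually.of_forall hf0)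
      Ioc_subset_Ioi_self.eventuallyLE

lemma integral_Ioi_le_mul_add_of_antitone {f : ℝ → ℝ} {y : ℝ} (hf : Antitone f)
    (hfi : IntegrableOn f (Ioi 0)) (hy : 0 ≤ y) :
    ∫ x in Ioi 0, f x ≤ y * f 0 + ∫ x in Ioi y, f x := by
  have hIoc := hfi.mono_set (Ioc_subset_Ioi_self : Ioc 0 y ⊆ Ioi 0)
  rw [← Ioc_union_Ioi_eq_Ioi hy, setIntegral_union (Ioc_disjoint_Ioi le_rfl) measurableSet_Ioi
    hIoc (hfi.mono_set (Ioi_subset_Ioi hy))]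
  gcongr
  calc ∫ x in Ioc 0 y, f x ≤ ∫ _ in Ioc 0 y, f 0 :=
        setIntegral_mono_on hIoc (by simp) measurableSet_Ioc fun _ hx => hf hx.1.le
    _ = y * f 0 := by simp [hy]

section APriori

variable {B : ℝ} {g : ℝ → ℝ} {μ : Rate} {s t x y : ℝ}

lemma flowSlope_mul_tail_le (hg : Profile B g) (ht : 0 ≤ t) (hx : 0 ≤ x) (hxy : x < y) :
    flowSlope μ t x y * tail (profileAt g μ t) y ≤ tail g (flow μ t y 0) := by
  set p := flowSlope μ t x y
  have hp : 0 < p := flowSlope_pos _ _ _ _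
  set F := flow μ t y 0
  have hF : p * y + (F - p * y) = F := add_sub_cancel _ _
  let f : ℝ → ℝ := fun z => g (z + (F - p * y))
  have hint : IntegrableOn (fun z => f (p * z)) (Ioi y) := by
    rw [integrableOn_Ioi_comp_mul_left_iff _ _ hp, integrableOn_Ioi_comp_add_right_iff, hF]
    exact hg.integrableOn_Ioi F
  -- Convexity of the flow bounds `g (flow μ t z 0)` by `g` along the chord of slope `p`.
  have hle : tail (profileAt g μ t) y ≤ ∫ z in Ioi y, f (p * z) := by
    refine setIntegral_mono_on ((integrableOn_profileAt hg ht).mono_set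
      (Ioi_subset_Ioi (hx.trans hxy.le))) hint measurableSet_Ioi
      fun z (hz : y < z) => hg.antitone ?_
    have := flow_add_flowSlope_mul_le (μ := μ) ht hx hxy hz.le
    linarith
  rw [integral_comp_mul_left_Ioi f y hp, setIntegral_Ioi_comp_add_right, hF, smul_eq_mul] at hle
  rwa [mul_comm, ← le_div_iff₀ hp, div_eq_inv_mul]

lemma profileAt_pos_of_tail_pos (hg : Profile B g) (ht : 0 ≤ t)
    (hpos : 0 < tail (profileAt g μ t) y) : 0 < profileAt g μ t y := by
  refine (hg.nonneg _).lt_of_ne' fun h => hpos.ne' ?_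
  exact setIntegral_eq_zero_of_forall_eq_zero fun z (hz : y < z) =>
    le_antisymm (h ▸ antitone_profileAt hg ht hz.le) (hg.nonneg _)

-- The bound on the beta function is inherited at later times.
lemma inv_profileAt_sub_le (hB : 0 ≤ B) (hg : Profile B g) (ht : 0 ≤ t) (hx : 0 ≤ x)
    (hxy : x ≤ y) (hpos : 0 < tail (profileAt g μ t) y) :
    1 / profileAt g μ t y - 1 / profileAt g μ t x ≤
      B * (y - x) / tail (profileAt g μ t) y := by
  rcases hxy.eq_or_lt with rfl | hlt
  · simp
  have htail := flowSlope_mul_tail_le (μ := μ) hg ht hx hlt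
  have hp : 0 < flowSlope μ t x y := flowSlope_pos _ _ _ _
  have hsub : flow μ t y 0 - flow μ t x 0 = flowSlope μ t x y * (y - x) := by
    have := flow_sub_flow (μ := μ) ht hx (hx.trans hxy) (Or.inr (hx.trans_lt hlt))
    linarith
  refine (hg.inv_sub_inv_le _ _ (flow_nonneg ht hx) (flow_mono ht hxy)
    (profileAt_pos_of_tail_pos hg ht hpos)).trans ?_
  rw [hsub, div_le_div_iff₀ ((mul_pos hp hpos).trans_le htail) hpos]
  calc B * (flowSlope μ t x y * (y - x)) * tail (profileAt g μ t) y
      = B * (y - x) * (flowSlope μ t x y * tail (profileAt g μ t) y) := by ring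
    _ ≤ B * (y - x) * tail g (flow μ t y 0) :=
      mul_le_mul_of_nonneg_left htail (mul_nonneg hB (sub_nonneg.2 hxy))

lemma one_sub_mul_le_tail (hg : Profile B g) (ht : 0 ≤ t)
    (hm : ∫ x in Ioi 0, profileAt g μ t x = 1) (hy : 0 ≤ y) :
    1 - y * profileAt g μ t 0 ≤ tail (profileAt g μ t) y := by
  have h := integral_Ioi_le_mul_add_of_antitone (antitone_profileAt (μ := μ) hg ht)
    (integrableOn_profileAt hg ht) hy
  rw [hm] at h
  exact sub_le_iff_le_add'.2 h

lemma profileAt_zero_pos (hg : Profile B g) (ht : 0 ≤ t)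
    (hm : ∫ x in Ioi 0, profileAt g μ t x = 1) : 0 < profileAt g μ t 0 :=
  profileAt_pos_of_tail_pos hg ht (one_pos.trans_eq hm.symm)

lemma inv_profileAt_zero_sub_le (hB : 0 ≤ B) (hg : Profile B g) (hs : 0 ≤ s) (hst : s ≤ t)
    (hm : ∫ x in Ioi 0, profileAt g μ s x = 1) (hlt : (t - s) * g 0 < 1) :
    1 / profileAt g μ t 0 - 1 / profileAt g μ s 0 ≤ B * (t - s) / (1 - (t - s) * g 0) := by
  have hy0 : 0 ≤ flow μ t 0 s := flow_nonneg hst le_rfl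
  have hyle : flow μ t 0 s ≤ t - s := by simpa using flow_le_add (μ := μ) hst 0
  have htail : 1 - (t - s) * g 0 ≤ tail (profileAt g μ s) (flow μ t 0 s) := by
    refine le_trans ?_ (one_sub_mul_le_tail hg hs hm hy0)
    have := mul_le_mul hyle (hg.le_zero (flow μ s 0 0)) (hg.nonneg _) (sub_nonneg.2 hst)
    rw [profileAt]
    linarith
  have hdiff := inv_profileAt_sub_le hB hg hs le_rfl hy0 ((sub_pos.2 hlt).trans_le htail)
  rw [profileAt_flow hs hst, sub_zero] at hdiff
  exact hdiff.trans (div_le_div₀ (mul_nonneg hB (sub_nonneg.2 hst))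
    (mul_le_mul_of_nonneg_left hyle hB) (sub_pos.2 hlt) htail)

lemma continuousWithinAt_profileAt_zero (hg : Profile B g) (ht : 0 ≤ t)
    (hpos : 0 < profileAt g μ t 0) :
    ContinuousWithinAt (fun s => profileAt g μ s 0) (Ici 0) t :=
  (hg.continuousAt _ hpos).comp_continuousWithinAt (f := fun s => flow μ s 0 0)
    (continuousOn_flow_zero hg μ t ht)

-- `1 / w(0,t)` is the mean size of the particles.
lemma inv_profileAt_zero_le (hB : 0 ≤ B) (hg : Profile B g) (ht : 0 ≤ t)
    (hm : ∀ s ∈ Icc 0 t, ∫ x in Ioi 0, profileAt g μ s x = 1) :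
    1 / profileAt g μ t 0 ≤ 1 / g 0 + B * t := by
  refine image_le_of_liminf_slope_right_le_deriv_boundary
    (f := fun s => 1 / profileAt g μ s 0) (B := fun s => 1 / g 0 + B * s) (B' := fun _ => B)
    (fun s hs => ?_) (by simp) (by fun_prop)
    (fun s _ => (((hasDerivAt_id s).const_mul B).const_add (1 / g 0)).hasDerivWithinAt.congr_deriv
      (mul_one B)) (fun s hs r hr => ?_) (right_mem_Icc.2 ht)
  · have hpos := profileAt_zero_pos hg hs.1 (hm s hs)
    exact continuousWithinAt_const.div ((continuousWithinAt_profileAt_zero hg hs.1 hpos).mono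
      Icc_subset_Ici_self) hpos.ne'
  · have hlim : Tendsto (fun z => (z - s) * g 0) (𝓝[>] s) (𝓝 0) :=
      (Continuous.tendsto' (by fun_prop) s 0 (by simp)).mono_left nhdsWithin_le_nhds
    have hslope : Tendsto (fun z => B / (1 - (z - s) * g 0)) (𝓝[>] s) (𝓝 B) := by
      simpa [div_eq_mul_inv] using
        ((hlim.const_sub 1).inv₀ (by simp)).const_mul B
    refine Eventually.frequently ?_
    filter_upwards [hlim.eventually_lt_const one_pos, hslope.eventually_lt_const hr,
      self_mem_nhdsWithin] with z hz hzr (hsz : s < z)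
    refine lt_of_le_of_lt ?_ hzr
    rw [slope_def_field, div_le_iff₀ (sub_pos.2 hsz), div_mul_eq_mul_div]
    exact inv_profileAt_zero_sub_le hB hg hs.1 hsz.le (hm s (Ico_subset_Icc_self hs)) hz

lemma profileAt_zero_div_le (hB : 0 ≤ B) (hg : Profile B g) (ht : 0 ≤ t)
    (hm : ∫ x in Ioi 0, profileAt g μ t x = 1) :
    profileAt g μ t 0 / (1 + B) ≤ profileAt g μ t (1 / profileAt g μ t 0 / 2) := by
  have hpos := profileAt_zero_pos hg ht hm
  set Λ := 1 / profileAt g μ t 0 with hΛ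
  have : 0 < Λ := by positivity
  have htail : 1 / 2 ≤ tail (profileAt g μ t) (Λ / 2) := by
    refine le_trans (le_of_eq ?_) (one_sub_mul_le_tail hg ht hm (by positivity))
    rw [hΛ]
    field_simp
    norm_num
  have hhalf : 0 < tail (profileAt g μ t) (Λ / 2) := one_half_pos.trans_le htail
  have hinv : 1 / profileAt g μ t (Λ / 2) ≤ Λ * (1 + B) := by
    have hdiff := inv_profileAt_sub_le hB hg ht le_rfl (y := Λ / 2) (by positivity) hhalf
    have hbound : B * (Λ / 2 - 0) / tail (profileAt g μ t) (Λ / 2) ≤ B * (Λ / 2 - 0) / (1 / 2) :=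
      div_le_div_of_nonneg_left (by rw [sub_zero]; positivity) one_half_pos htail
    rw [← hΛ] at hdiff
    linarith
  have hΛB : profileAt g μ t 0 / (1 + B) = 1 / (Λ * (1 + B)) := by
    rw [hΛ]
    field_simp
  rw [hΛB]
  exact (one_div_le (profileAt_pos_of_tail_pos hg ht hhalf) (by positivity)).1 hinv

lemma cbrt_mul_le_radiusSum (hB : 0 ≤ B) (hg : Profile B g) (ht : 0 ≤ t)
    (hm : ∫ x in Ioi 0, profileAt g μ t x = 1) :
    cbrt (1 / profileAt g μ t 0 / 2) * (profileAt g μ t 0 / (1 + B)) ≤ radiusSum g μ t := by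
  have hpos := profileAt_zero_pos hg ht hm
  refine le_trans (mul_le_mul_of_nonneg_left ?_ (cbrt_nonneg _)) (mul_le_integral_Ioi_of_antitone
    (antitone_profileAt_cube hg ht) (fun _ => hg.nonneg _) (integrableOn_profileAt_cube hg ht)
    (cbrt_nonneg (1 / profileAt g μ t 0 / 2)))
  rw [cbrt_pow_three (by positivity)]
  exact profileAt_zero_div_le hB hg ht hm

lemma radiusSum_le_mul_add (hg : Profile B g) (ht : 0 ≤ t)
    (hm : ∫ x in Ioi 0, profileAt g μ t x = 1) {R : ℝ} (hR : 0 < R) :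
    radiusSum g μ t ≤ R * profileAt g μ t 0 + 1 / (2 * R ^ 2) := by
  have hi := integrableOn_profileAt_cube (μ := μ) hg ht
  have hcube : ∀ {ρ : ℝ}, 0 < ρ → profileAt g μ t (ρ ^ 3) ≤ ρ ^ (-3 : ℝ) := fun {ρ} hρ => by
    have h := mul_le_integral_Ioi_of_antitone (antitone_profileAt (μ := μ) hg ht)
      (fun _ => hg.nonneg _) (integrableOn_profileAt hg ht) (y := ρ ^ 3) (by positivity)
    rw [hm, mul_comm] at h
    rw [Real.rpow_neg hρ.le, Real.rpow_ofNat, ← one_div, le_div_iff₀ (by positivity)]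
    exact h
  have htail : ∫ ρ in Ioi R, profileAt g μ t (ρ ^ 3) ≤ 1 / (2 * R ^ 2) :=
    calc ∫ ρ in Ioi R, profileAt g μ t (ρ ^ 3) ≤ ∫ ρ in Ioi R, ρ ^ (-3 : ℝ) :=
          setIntegral_mono_on (hi.mono_set (Ioi_subset_Ioi hR.le))
            (integrableOn_Ioi_rpow_of_lt (by norm_num) hR) measurableSet_Ioi
            fun ρ hρ => hcube (hR.trans hρ)
      _ = 1 / (2 * R ^ 2) := by
          rw [integral_Ioi_rpow_of_lt (by norm_num) hR,
            show (-3 + 1 : ℝ) = -((2 : ℕ) : ℝ) by norm_num, Real.rpow_neg hR.le, Real.rpow_natCast]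
          field_simp
          norm_num
  have hsplit :=
    integral_Ioi_le_mul_add_of_antitone (antitone_profileAt_cube (μ := μ) hg ht) hi hR.le
  rw [zero_pow three_ne_zero] at hsplit
  exact hsplit.trans (add_le_add_right htail _)

end APriori

/-! ### Existence of a self-consistent rate -/

/-- The relation between the rate and the profile in the LSW system. -/
def IsSelfConsistent (g : ℝ → ℝ) (μ : Rate) : Prop :=
  ∀ t, 0 ≤ t → μ t * radiusSum g μ t = profileAt g μ t 0

section Existence

variable {B : ℝ} {g : ℝ → ℝ}

lemma exists_lt_radiusSum (hB : 0 ≤ B) (hg : Profile B g) :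
    ∃ c : ℝ → ℝ, Continuous c ∧ Antitone c ∧ (∀ t, 0 < c t) ∧ ∀ μ t, 0 ≤ t →
      (∀ s ∈ Icc 0 t, ∫ x in Ioi 0, profileAt g μ s x = 1) → c t < radiusSum g μ t := by
  have hg0 := hg.zero_pos
  set Λ₀ := 1 / g 0
  have : 0 < Λ₀ := by positivity
  have hcbrt : 0 < cbrt (Λ₀ / 2) := cbrt_pos (by positivity)
  have hden : ∀ t, 0 < 2 * (1 + B) * (Λ₀ + B * max t 0) := fun t => by positivity
  refine ⟨fun t => cbrt (Λ₀ / 2) / (2 * (1 + B) * (Λ₀ + B * max t 0)),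
    Continuous.div (by fun_prop) (by fun_prop) fun t => (hden t).ne',
    fun s t hst => div_le_div_of_nonneg_left hcbrt.le (hden s) (by gcongr),
    fun t => div_pos hcbrt (hden t), fun μ t ht hm => ?_⟩
  have hmt := hm t (right_mem_Icc.2 ht)
  have hpos := profileAt_zero_pos hg ht hmt
  have hlow : Λ₀ ≤ 1 / profileAt g μ t 0 := one_div_le_one_div_of_le hpos (hg.le_zero _)
  have hhigh : 1 / profileAt g μ t 0 ≤ Λ₀ + B * t := inv_profileAt_zero_le hB hg ht hm
  have hsum : 0 < (1 + B) * (Λ₀ + B * t) := by positivity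
  calc cbrt (Λ₀ / 2) / (2 * (1 + B) * (Λ₀ + B * max t 0))
      = cbrt (Λ₀ / 2) / (2 * (1 + B) * (Λ₀ + B * t)) := by rw [max_eq_left ht]
    _ < cbrt (Λ₀ / 2) / ((1 + B) * (Λ₀ + B * t)) :=
        div_lt_div_of_pos_left hcbrt hsum (by linarith)
    _ ≤ cbrt (1 / profileAt g μ t 0 / 2) / ((1 + B) * (1 / profileAt g μ t 0)) :=
        div_le_div₀ (cbrt_nonneg _) (monotone_cbrt (by linarith)) (by positivity)
          (mul_le_mul_of_nonneg_left hhigh (by positivity))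
    _ = cbrt (1 / profileAt g μ t 0 / 2) * (profileAt g μ t 0 / (1 + B)) := by field_simp
    _ ≤ radiusSum g μ t := cbrt_mul_le_radiusSum hB hg ht hmt

lemma mul_profileAt_zero_le_tail {μ : Rate} {t d : ℝ} (hB : 0 ≤ B) (hg : Profile B g)
    (ht : 0 ≤ t) (hm : ∫ x in Ioi 0, profileAt g μ t x = 1) (hd0 : 0 ≤ d)
    (hd : d ≤ flow μ t (1 / g 0 / 2) 0 - flow μ t 0 0) :
    d * (profileAt g μ t 0 / (1 + B)) ≤ tail g (flow μ t 0 0) := by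
  have hg0 := hg.zero_pos
  have hpos := profileAt_zero_pos hg ht hm
  have hle : 1 / g 0 / 2 ≤ 1 / profileAt g μ t 0 / 2 :=
    div_le_div_of_nonneg_right (one_div_le_one_div_of_le hpos (hg.le_zero _)) zero_le_two
  calc d * (profileAt g μ t 0 / (1 + B))
      ≤ (flow μ t (1 / g 0 / 2) 0 - flow μ t 0 0) * g (flow μ t (1 / g 0 / 2) 0) :=
        mul_le_mul hd ((profileAt_zero_div_le hB hg ht hm).trans (antitone_profileAt hg ht hle))
          (by positivity) (hd0.trans hd)
    _ ≤ tail g (flow μ t 0 0) - tail g (flow μ t (1 / g 0 / 2) 0) :=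
        hg.mul_le_tail_sub_tail (flow_mono ht (by positivity))
    _ ≤ tail g (flow μ t 0 0) := sub_le_self _ (hg.tail_nonneg _)

lemma exists_profileAt_zero_lt_mul_tail (hB : 0 ≤ B) (hg : Profile B g) {M : ℝ → ℝ}
    (hMc : Continuous M) (hM : ∀ t, 0 < M t) :
    ∃ K : ℝ → ℝ, Continuous K ∧ (∀ t, 0 ≤ K t) ∧ ∀ (μ : Rate) (t : ℝ), 0 ≤ t →
      (∀ u ∈ Icc 0 t, μ u ≤ M t) → ∫ x in Ioi 0, profileAt g μ t x = 1 →
      profileAt g μ t 0 < K t * tail g (flow μ t 0 0) := by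
  have hg0 := hg.zero_pos
  set x₀ := 1 / g 0 / 2
  have hx₀pos : 0 < x₀ := by positivity
  let m : ℝ → ℝ := fun t => cbrt (min x₀ ((1 / M t) ^ 3))
  have hm : ∀ t, 0 < m t := fun t =>
    cbrt_pos (lt_min hx₀pos (pow_pos (one_div_pos.2 (hM t)) 3))
  have hmc : Continuous m := continuous_cbrt.comp
    (continuous_const.min ((continuous_const.div hMc fun t => (hM t).ne').pow 3))
  let d : ℝ → ℝ := fun t => Real.exp (-(M t / m t ^ 2 * t)) * x₀
  have hd : ∀ t, 0 < d t := fun t => mul_pos (Real.exp_pos _) hx₀pos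
  have hdc : Continuous d := (Real.continuous_exp.comp ((hMc.div (hmc.pow 2)
    fun t => (pow_pos (hm t) 2).ne').mul continuous_id).neg).mul continuous_const
  refine ⟨fun t => 2 * (1 + B) / d t, continuous_const.div hdc fun t => (hd t).ne',
    fun t => div_nonneg (by positivity) (hd t).le, fun μ t ht hμ hmass => ?_⟩
  have hpos := profileAt_zero_pos hg ht hmass
  have hdflow : d t ≤ flow μ t x₀ 0 - flow μ t 0 0 := by
    rw [flow_sub_flow ht hx₀pos.le le_rfl (Or.inl hx₀pos), sub_zero]
    exact mul_le_mul_of_nonneg_right (exp_neg_le_flowSlope ht (hM t) hμ hx₀pos) hx₀pos.le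
  have hdt := hd t
  calc profileAt g μ t 0 < 2 * profileAt g μ t 0 := by linarith
    _ = 2 * (1 + B) / d t * (d t * (profileAt g μ t 0 / (1 + B))) := by field_simp
    _ ≤ 2 * (1 + B) / d t * tail g (flow μ t 0 0) :=
      mul_le_mul_of_nonneg_left (mul_profileAt_zero_le_tail hB hg ht hmass hdt.le hdflow)
        (by positivity)

lemma forall_of_forall_Ico_imp_eventually {P : ℝ → Prop} {a : ℝ}
    (h : ∀ T ≥ a, (∀ s ∈ Ico a T, P s) → ∀ᶠ s in 𝓝[≥] T, P s) : ∀ t ≥ a, P t := by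
  by_contra! hnot
  set S : Set ℝ := {t | a ≤ t ∧ ¬P t}
  have hS : S.Nonempty := hnot
  have hbdd : BddBelow S := ⟨a, fun t ht => ht.1⟩
  have hbefore : ∀ s ∈ Ico a (sInf S), P s := fun s hs => by
    by_contra hPs
    exact hs.2.not_ge (csInf_le hbdd ⟨hs.1, hPs⟩)
  have hev := h (sInf S) (le_csInf hS fun t ht => ht.1) hbefore
  obtain ⟨u, hu, hsub⟩ := mem_nhdsGE_iff_exists_Ico_subset.1 hev
  obtain ⟨s, hsS, hsu⟩ := exists_lt_of_csInf_lt hS hu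
  exact hsS.2 (hsub ⟨csInf_le hbdd hsS, hsu⟩)

lemma exists_isSelfConsistent (hB : 0 ≤ B) (hg : Profile B g) :
    ∃ μ : Rate, IsSelfConsistent g μ := by
  obtain ⟨c, hcc, hca, hc0, hc⟩ := exists_lt_radiusSum hB hg
  obtain ⟨K, hKc, hK0, hK⟩ := exists_profileAt_zero_lt_mul_tail hB hg (M := fun t => g 0 / c t)
    (continuous_const.div hcc fun t => (hc0 t).ne') fun t => div_pos hg.zero_pos (hc0 t)
  obtain ⟨μ, hμ⟩ := exists_rate_eq_response hg hKc hK0 hcc hc0 hca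
  have hμle : ∀ t, ∀ u ∈ Icc 0 t, μ u ≤ g 0 / c t := fun t u hu => by
    rw [hμ u hu.1]
    exact div_le_div₀ (hg.nonneg 0) ((min_le_left _ _).trans (hg.le_zero _)) (hc0 t)
      ((hca hu.2).trans (le_max_right _ _))
  have hinactive : ∀ t ≥ 0, profileAt g μ t 0 < K t * tail g (flow μ t 0 0) →
      c t < radiusSum g μ t → μ t * radiusSum g μ t = profileAt g μ t 0 := fun t ht hKt hct => by
    have hR : radiusSum g μ t ≠ 0 := ((hc0 t).trans hct).ne'
    rw [hμ t ht, response, state, max_eq_left hct.le, div_mul_cancel₀ _ hR]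
    exact min_eq_left hKt.le
  refine ⟨μ, forall_of_forall_Ico_imp_eventually fun T hT hbefore => ?_⟩
  have hmass : ∀ s ∈ Icc 0 T, ∫ x in Ioi 0, profileAt g μ s x = 1 := fun s hs =>
    integral_profileAt_eq_one hg hs.1 fun u hu => hbefore u ⟨hu.1, hu.2.trans_le hs.2⟩
  have hmassT := hmass T (right_mem_Icc.2 hT)
  have hflow := continuousOn_flow_zero hg μ T hT
  have hprofile : ∀ᶠ s in 𝓝[≥] T, profileAt g μ s 0 < K s * tail g (flow μ s 0 0) :=
    (((continuousWithinAt_profileAt_zero hg hT (profileAt_zero_pos hg hT hmassT)).eventually_lt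
      (hKc.continuousWithinAt.mul (hg.continuous_tail.continuousAt.comp_continuousWithinAt hflow))
      (hK μ T hT (hμle T) hmassT)).filter_mono (nhdsWithin_mono T (Ici_subset_Ici.2 hT)))
  have hradius : ∀ᶠ s in 𝓝[≥] T, c s < radiusSum g μ s :=
    (hcc.continuousWithinAt.eventually_lt (continuousOn_radiusSum hg μ T hT)
      (hc μ T hT hmass)).filter_mono (nhdsWithin_mono T (Ici_subset_Ici.2 hT))
  filter_upwards [hprofile, hradius, self_mem_nhdsWithin] with s hsK hsc hTs
  exact hinactive s (hT.trans hTs) hsK hsc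

end Existence

/-! ### Differentiability of the flow -/

section FlowDerivative

variable {μ : Rate} {t x : ℝ}

lemma exists_isTrajectory_eq (μ : Rate) (t x : ℝ) :
    ∃ Z : ℝ → ℝ, Continuous Z ∧ Z t = x ∧ IsTrajectory μ (t + 1) Z := by
  obtain ⟨z, hz⟩ := surjective_flow (μ := μ) (le_add_of_nonneg_right zero_le_one : t ≤ t + 1) x
  exact ⟨flow μ (t + 1) z, continuous_flow, hz, isTrajectory_flow⟩

-- All characteristics issued near `(t, x)` stay close to a single one that passes through `(t, x)`
-- and extends beyond the time `t`.
lemma continuous_flow_min (μ : Rate) :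
    Continuous fun p : ℝ × ℝ × ℝ => flow μ p.1 p.2.1 (min p.2.2 p.1) := by
  refine continuous_iff_continuousAt.2 fun ⟨t, x, s⟩ => ?_
  obtain ⟨Z, hZc, hZt, hZ⟩ := exists_isTrajectory_eq μ t x
  have hlim : Tendsto (fun p : ℝ × ℝ × ℝ => |p.2.1 - Z p.1| +
      |Z (min p.2.2 p.1) - Z (min s t)|) (𝓝 (t, x, s)) (𝓝 0) :=
    Continuous.tendsto' (by fun_prop) _ _ (by simp [hZt])
  rw [ContinuousAt, tendsto_iff_dist_tendsto_zero]
  refine squeeze_zero' (Eventually.of_forall fun _ => dist_nonneg) ?_ hlim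
  filter_upwards [continuous_fst.continuousAt.eventually_lt_const (lt_add_one t)] with p hp
  have hclose : |flow μ p.1 p.2.1 (min p.2.2 p.1) - Z (min p.2.2 p.1)| ≤ |p.2.1 - Z p.1| := by
    rw [(hZ.mono hp.le).eq_flow (min_le_right p.2.2 p.1)]
    exact abs_flow_sub_le (min_le_right _ _) _ _
  have hbase : flow μ t x (min s t) = Z (min s t) := by
    rw [(hZ.mono (le_add_of_nonneg_right zero_le_one)).eq_flow (min_le_right s t), hZt]
  rw [Real.dist_eq, hbase]
  exact (abs_sub_le _ (Z (min p.2.2 p.1)) _).trans (by gcongr)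

lemma continuousAt_flowSlope (ht : 0 < t) (hx : 0 < x) :
    ContinuousAt (fun p : ℝ × ℝ × ℝ => flowSlope μ p.1 p.2.1 p.2.2) (t, x, x) := by
  set U : Set (ℝ × ℝ × ℝ) := {p | 0 < p.2.1}
  have hU : U ∈ 𝓝 (t, x, x) := (isOpen_lt continuous_const (by fun_prop)).mem_nhds hx
  let f : ℝ × ℝ × ℝ → ℝ → ℝ := fun p s => μ s /
    cbrtDen (flow μ p.1 p.2.1 (min s p.1)) (flow μ p.1 p.2.2 (min s p.1))
  have hflow : ∀ π : ℝ × ℝ × ℝ → ℝ, Continuous π →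
      Continuous fun q : U × ℝ => flow μ q.1.1.1 (π q.1.1) (min q.2 q.1.1.1) := fun π hπ =>
    (continuous_flow_min μ).comp (f := fun q : U × ℝ => (q.1.1.1, π q.1.1, q.2)) (by fun_prop)
  have hf : Continuous (Function.uncurry fun p : U => f p) :=
    Continuous.div (by fun_prop) (continuous_cbrtDen.comp
      ((hflow (fun p => p.2.1) (by fun_prop)).prodMk (hflow (fun p => p.2.2) (by fun_prop))))
      fun q => (cbrtDen_flow_pos (Or.inl q.1.2) (min_le_right _ _)).ne'
  have hint : ContinuousOn (fun p => ∫ s in (0 : ℝ)..p.1, f p s) U :=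
    continuousOn_iff_continuous_domRestrict.2
      (intervalIntegral.continuous_parametric_intervalIntegral_of_continuous hf
        (s := fun p : U => p.1.1) (by fun_prop))
  refine (hint.continuousAt hU).neg.rexp.congr ?_
  filter_upwards [continuous_fst.continuousAt.eventually_const_lt ht] with p hp
  have hfp : ∀ s ∈ Ioo 0 p.1, f p s = μ s / cbrtDen (flow μ p.1 p.2.1 s) (flow μ p.1 p.2.2 s) :=
    fun s hs => by simp only [f, min_eq_left hs.2.le]
  exact congrArg (fun I => Real.exp (-I)) (intervalIntegral.integral_congr_Ioo_of_le hp.le hfp)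

lemma hasDerivAt_flow_space (ht : 0 < t) (hx : 0 < x) :
    HasDerivAt (fun y => flow μ t y 0) (flowSlope μ t x x) x := by
  rw [hasDerivAt_iff_tendsto_slope]
  have hslope : Tendsto (fun y => flowSlope μ t y x) (𝓝[≠] x) (𝓝 (flowSlope μ t x x)) :=
    (ContinuousAt.comp (f := fun y => (t, y, x)) (continuousAt_flowSlope ht hx)
      (by fun_prop)).mono_left nhdsWithin_le_nhds
  refine hslope.congr' ?_
  filter_upwards [self_mem_nhdsWithin, nhdsWithin_le_nhds (lt_mem_nhds hx)] with y hne hy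
  rw [slope_def_field, flow_sub_flow ht.le hy.le hx.le (Or.inl hy),
    mul_div_cancel_right₀ _ (sub_ne_zero.2 hne)]

lemma hasDerivAt_flow_time (ht : 0 < t) (hx : 0 < x) :
    HasDerivAt (fun s => flow μ s x 0) (flowSlope μ t x x * (1 - μ t * cbrt x)) t := by
  obtain ⟨Z, hZc, rfl, hZ⟩ := exists_isTrajectory_eq μ t x
  have hlt := lt_add_one t
  rw [hasDerivAt_iff_tendsto_slope]
  have hslope : Tendsto (fun s => flowSlope μ s (Z t) (Z s)) (𝓝[≠] t)
      (𝓝 (flowSlope μ t (Z t) (Z t))) :=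
    (ContinuousAt.comp (f := fun s => (s, Z t, Z s)) (continuousAt_flowSlope ht hx)
      (by fun_prop)).mono_left nhdsWithin_le_nhds
  have hprod := hslope.mul (hasDerivAt_iff_tendsto_slope.1 (hZ t hlt.le)).neg
  rw [neg_add', neg_neg] at hprod
  refine hprod.congr' ?_
  filter_upwards [nhdsWithin_le_nhds (lt_mem_nhds ht), nhdsWithin_le_nhds (gt_mem_nhds hlt),
    nhdsWithin_le_nhds (hZc.continuousAt.eventually_const_lt hx)] with s hs0 hsT hZs
  have hflow : flow μ t (Z t) 0 = flow μ s (Z s) 0 := by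
    rw [← (hZ.mono hlt.le).eq_flow ht.le, ← (hZ.mono hsT.le).eq_flow hs0.le]
  rw [slope_def_field, slope_def_field, hflow, flow_sub_flow hs0.le hx.le
    hZs.le (Or.inl hx)]
  ring

end FlowDerivative

/-! ### Self-consistent rates give global solutions -/

section Solution

variable {B : ℝ} {g : ℝ → ℝ} {μ : Rate} {t x : ℝ}

-- The substitution `x = ρ ^ 3` absorbs the weight `x ^ (-2/3) / 3`.
lemma volumeL_eq (w : ℝ → ℝ) : volumeL w = ((∫ ρ in Ioi 0, w (ρ ^ 3)) / w 0) ^ 3 := by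
  have h := integral_comp_rpow_Ioi (fun ρ => w (ρ ^ 3)) (p := 1 / 3) (by norm_num)
  rw [volumeL, ← h, ← integral_const_mul]
  congr 2
  refine setIntegral_congr_fun measurableSet_Ioi fun x (hx : 0 < x) => ?_
  simp only [smul_eq_mul]
  rw [← cbrt_eq_rpow hx.le, cbrt_pow_three hx.le]
  norm_num
  ring

lemma volumeL_profileAt : volumeL (profileAt g μ t) =
    (radiusSum g μ t / profileAt g μ t 0) ^ 3 := volumeL_eq _

lemma le_supportEnd {w : ℝ → ℝ} (hx : 0 ≤ x) (hpos : 0 < w x) : (x : EReal) ≤ supportEnd w :=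
  le_sSup ⟨x, hx, hpos, rfl⟩

lemma supportEnd_le {w : ℝ → ℝ} (hw : Antitone w) (hx : w x = 0) : supportEnd w ≤ x := by
  refine sSup_le ?_
  rintro _ ⟨y, -, hy, rfl⟩
  exact EReal.coe_le_coe_iff.2 (not_lt.1 fun hxy => hy.not_ge (hx ▸ hw hxy.le))

namespace IsSelfConsistent

lemma integral_eq_one (h : IsSelfConsistent g μ) (hg : Profile B g) (ht : 0 ≤ t) :
    ∫ x in Ioi 0, profileAt g μ t x = 1 :=
  integral_profileAt_eq_one hg ht fun s hs => h s hs.1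

lemma profileAt_zero_pos (h : IsSelfConsistent g μ) (hg : Profile B g) (ht : 0 ≤ t) :
    0 < profileAt g μ t 0 := LSW.profileAt_zero_pos hg ht (h.integral_eq_one hg ht)

lemma radiusSum_pos (h : IsSelfConsistent g μ) (hg : Profile B g) (ht : 0 ≤ t) :
    0 < radiusSum g μ t :=
  pos_of_mul_pos_right ((h.profileAt_zero_pos hg ht).trans_eq (h t ht).symm) (μ.nonneg t)

lemma rate_eq (h : IsSelfConsistent g μ) (hg : Profile B g) (ht : 0 ≤ t) :
    μ t = profileAt g μ t 0 / radiusSum g μ t :=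
  eq_div_of_mul_eq (h.radiusSum_pos hg ht).ne' (h t ht)

lemma div_volumeL_rpow (h : IsSelfConsistent g μ) (hg : Profile B g) (ht : 0 ≤ t) (hx : 0 ≤ x) :
    (x / volumeL (profileAt g μ t)) ^ (1 / 3 : ℝ) = μ t * cbrt x := by
  have := h.profileAt_zero_pos hg ht
  have := h.radiusSum_pos hg ht
  have hnonneg := mul_nonneg (μ.nonneg t) (cbrt_nonneg x)
  have hcube : x / volumeL (profileAt g μ t) = (μ t * cbrt x) ^ 3 := by
    rw [volumeL_profileAt, mul_pow, cbrt_pow_three hx, h.rate_eq hg ht]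
    field_simp
  rw [hcube, ← cbrt_eq_rpow (by positivity), cbrt_cube hnonneg]

lemma differentiableAt_flow (h : IsSelfConsistent g μ) (hg : Profile B g) (ht : 0 ≤ t)
    (hx : 0 < x) (hne : (x : EReal) ≠ supportEnd (profileAt g μ t)) :
    DifferentiableAt ℝ g (flow μ t x 0) := by
  rcases (hg.nonneg (flow μ t x 0)).eq_or_lt' with hzero | hpos
  · have hle := supportEnd_le (antitone_profileAt (μ := μ) hg ht) hzero
    obtain ⟨y, hy, hyx⟩ := EReal.lt_iff_exists_real_btwn.1 (hle.lt_of_ne' hne)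
    have hy0 : 0 < y := by
      exact_mod_cast (le_supportEnd le_rfl (h.profileAt_zero_pos hg ht)).trans_lt hy
    have hgy : g (flow μ t y 0) ≤ 0 :=
      not_lt.1 fun hpos => hy.not_ge (le_supportEnd hy0.le hpos)
    have hconst : g =ᶠ[𝓝 (flow μ t x 0)] fun _ => 0 := by
      filter_upwards [lt_mem_nhds (flow_zero_lt (μ := μ) ht hy0.le (EReal.coe_lt_coe_iff.1 hyx))]
        with z hz
      exact le_antisymm ((hg.antitone hz.le).trans hgy) (hg.nonneg z)
    exact (differentiableAt_const 0).congr_of_eventuallyEq hconst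
  · exact hg.differentiableAt _ (flow_pos ht hx) hpos

lemma isGlobalSolution (h : IsSelfConsistent g μ) (hg : Profile B g) {w₀ : ℝ → ℝ}
    (hgw : ∀ x, 0 ≤ x → g x = w₀ x) : IsGlobalSolution w₀ fun x t => profileAt g μ t x where
  initial x hx := by rw [profileAt_time_zero, hgw x hx]
  memE t ht :=
    { nonneg := fun x _ => profileAt_nonneg hg x
      antitone := (antitone_profileAt hg ht).antitoneOn _
      integrable := integrableOn_profileAt hg ht
      rightCont := fun x _ => (hg.rightCont _).comp (t := Ici (flow μ t x 0))
        (continuous_flow_left ht).continuousWithinAt fun _ hy => flow_mono ht hy }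
  mass t ht := h.integral_eq_one hg ht
  L_cont := by
    have hzero : ContinuousOn (fun t => profileAt g μ t 0) (Ici 0) := fun t ht =>
      continuousWithinAt_profileAt_zero hg ht (h.profileAt_zero_pos hg ht)
    exact (((continuousOn_radiusSum hg μ).div hzero
      fun t ht => (h.profileAt_zero_pos hg ht).ne').pow 3).congr fun t _ => volumeL_profileAt
  pde x t hx ht hne := by
    have hderiv := (h.differentiableAt_flow hg ht.le hx hne).hasDerivAt
    refine ⟨_, hderiv.comp x (hasDerivAt_flow_space ht hx), ?_⟩
    rw [h.div_volumeL_rpow hg ht.le hx.le]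
    exact (hderiv.comp t (hasDerivAt_flow_time ht hx)).congr_deriv (by ring)
  characteristics x t hx ht := by
    refine ⟨flow μ t x, fun s hs => ⟨flow_nonneg hs.2 hx, ?_⟩, flow_self,
      hgw _ (flow_nonneg ht hx)⟩
    rw [h.div_volumeL_rpow hg hs.1 (flow_nonneg hs.2 hx)]
    exact (isTrajectory_flow s hs.2).hasDerivWithinAt.congr_deriv (by ring)

/-! ### The coarsening bound -/

lemma inv_profileAt_zero_le (h : IsSelfConsistent g μ) (hB : 0 ≤ B) (hg : Profile B g)
    (ht : 0 ≤ t) : 1 / profileAt g μ t 0 ≤ 1 / g 0 + B * t :=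
  LSW.inv_profileAt_zero_le hB hg ht fun _ hs => h.integral_eq_one hg hs.1

lemma cbrt_div_le_radiusSum_div (h : IsSelfConsistent g μ) (hB : 0 ≤ B) (hg : Profile B g)
    (ht : 0 ≤ t) :
    cbrt (1 / g 0 / 2) / (1 + B) ≤ radiusSum g μ t / profileAt g μ t 0 := by
  have hpos := h.profileAt_zero_pos hg ht
  have hle : 1 / g 0 ≤ 1 / profileAt g μ t 0 := one_div_le_one_div_of_le hpos (hg.le_zero _)
  rw [le_div_iff₀ hpos]
  calc cbrt (1 / g 0 / 2) / (1 + B) * profileAt g μ t 0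
      = cbrt (1 / g 0 / 2) * (profileAt g μ t 0 / (1 + B)) := by ring
    _ ≤ cbrt (1 / profileAt g μ t 0 / 2) * (profileAt g μ t 0 / (1 + B)) :=
        mul_le_mul_of_nonneg_right (monotone_cbrt (by linarith)) (by positivity)
    _ ≤ radiusSum g μ t := cbrt_mul_le_radiusSum hB hg ht (h.integral_eq_one hg ht)

lemma volumeL_le_div_profileAt_zero (h : IsSelfConsistent g μ) (hg : Profile B g) (ht : 0 ≤ t) :
    volumeL (profileAt g μ t) ≤ 4 / profileAt g μ t 0 := by
  have hpos := h.profileAt_zero_pos hg ht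
  set R := cbrt (1 / profileAt g μ t 0)
  have hR : 0 < R := cbrt_pos (by positivity)
  have hR3 : R ^ 3 = 1 / profileAt g μ t 0 := cbrt_pow_three (by positivity)
  have hratio : radiusSum g μ t / profileAt g μ t 0 ≤ 3 / 2 * R :=
    calc radiusSum g μ t / profileAt g μ t 0
        ≤ (R * profileAt g μ t 0 + 1 / (2 * R ^ 2)) / profileAt g μ t 0 := by
          gcongr
          exact radiusSum_le_mul_add hg ht (h.integral_eq_one hg ht) hR
      _ = R + R ^ 3 / (2 * R ^ 2) := by rw [hR3]; field_simp
      _ = 3 / 2 * R := by field_simp; norm_num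
  calc volumeL (profileAt g μ t) = (radiusSum g μ t / profileAt g μ t 0) ^ 3 := volumeL_profileAt
    _ ≤ (3 / 2 * R) ^ 3 :=
        pow_le_pow_left₀ (div_nonneg (h.radiusSum_pos hg ht).le hpos.le) hratio 3
    _ = 27 / 8 * (1 / profileAt g μ t 0) := by rw [mul_pow, hR3]; norm_num
    _ ≤ 4 / profileAt g μ t 0 := by
        rw [mul_one_div]
        gcongr
        norm_num

lemma rate_le (h : IsSelfConsistent g μ) (hB : 0 ≤ B) (hg : Profile B g) (ht : 0 ≤ t) :
    μ t ≤ (1 + B) / cbrt (1 / g 0 / 2) := by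
  have hg0 := hg.zero_pos
  have : 0 < cbrt (1 / g 0 / 2) := cbrt_pos (by positivity)
  rw [h.rate_eq hg ht, ← one_div_div, ← one_div_div (cbrt _)]
  exact one_div_le_one_div_of_le (by positivity) (h.cbrt_div_le_radiusSum_div hB hg ht)

lemma radiusSum_le_of_le (h : IsSelfConsistent g μ) (hB : 0 ≤ B) (hg : Profile B g) (ht : 0 ≤ t)
    (hsmall : 800 * (1 + B) ^ 3 * t ≤ 1 / g 0) :
    radiusSum g μ t ≤ 21 / 20 * radiusSum g μ 0 := by
  have hg0 := hg.zero_pos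
  have hdisp := radiusSum_le hg le_rfl ht fun u hu => h.rate_le hB hg hu.1
  have hlow := h.cbrt_div_le_radiusSum_div hB hg le_rfl
  rw [profileAt_time_zero] at hlow hdisp
  set a := cbrt (1 / g 0 / 2)
  have ha : 0 < a := cbrt_pos (by positivity)
  have ha3 : a ^ 3 = 1 / g 0 / 2 := cbrt_pow_three (by positivity)
  have hsqrt : √(2 / 3 * ((1 + B) / a) * (t - 0)) ≤ a / (1 + B) / 20 := by
    refine (Real.sqrt_le_left (by positivity)).2 ?_
    rw [div_pow, div_pow, sub_zero, div_div, le_div_iff₀ (by positivity)]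
    have : 2 / 3 * ((1 + B) / a) * t * ((1 + B) ^ 2 * 20 ^ 2) =
      800 * (1 + B) ^ 3 * t / (3 * a) := by field_simp; ring
    rw [this, div_le_iff₀ (by positivity)]
    nlinarith
  calc radiusSum g μ t ≤ radiusSum g μ 0 + a / (1 + B) / 20 * g 0 := hdisp.trans (by gcongr)
    _ ≤ radiusSum g μ 0 + radiusSum g μ 0 / g 0 / 20 * g 0 := by gcongr
    _ = 21 / 20 * radiusSum g μ 0 := by field_simp; norm_num

lemma inv_profileAt_zero_le_of_le (h : IsSelfConsistent g μ) (hB : 0 ≤ B) (hg : Profile B g)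
    (ht : 0 ≤ t) (hsmall : 800 * (1 + B) ^ 3 * t ≤ 1 / g 0) :
    1 / profileAt g μ t 0 ≤ 21 / 20 * (1 / g 0) := by
  have hcube : B ≤ (1 + B) ^ 3 := by nlinarith [pow_nonneg hB 3, pow_nonneg hB 2]
  have hBt : B * t ≤ (1 + B) ^ 3 * t := by gcongr
  have : 0 ≤ B * t := by positivity
  linarith [h.inv_profileAt_zero_le hB hg ht]

lemma volumeL_le_two_mul (h : IsSelfConsistent g μ) (hB : 0 ≤ B) (hg : Profile B g) (ht : 0 ≤ t)
    (hsmall : 800 * (1 + B) ^ 3 * t ≤ 1 / g 0) :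
    volumeL (profileAt g μ t) ≤ 2 * volumeL (profileAt g μ 0) := by
  have hg0 := hg.zero_pos
  have hpos := h.profileAt_zero_pos hg ht
  have hR0 := h.radiusSum_pos hg le_rfl
  have hR := h.radiusSum_pos hg ht
  rw [volumeL_profileAt, volumeL_profileAt, profileAt_time_zero]
  calc (radiusSum g μ t / profileAt g μ t 0) ^ 3
      = (radiusSum g μ t * (1 / profileAt g μ t 0)) ^ 3 := by rw [mul_one_div]
    _ ≤ (21 / 20 * radiusSum g μ 0 * (21 / 20 * (1 / g 0))) ^ 3 :=
        pow_le_pow_left₀ (by positivity) (mul_le_mul (h.radiusSum_le_of_le hB hg ht hsmall)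
          (h.inv_profileAt_zero_le_of_le hB hg ht hsmall) (by positivity) (by positivity)) 3
    _ = (21 / 20) ^ 6 * (radiusSum g μ 0 / g 0) ^ 3 := by ring
    _ ≤ 2 * (radiusSum g μ 0 / g 0) ^ 3 := by
        gcongr
        norm_num

-- Up to a time comparable to the initial mean size `1 / g 0` the parameter `L` has at most doubled;
-- afterwards the mean size, which bounds `L`, is itself bounded by a multiple of `t`.
lemma volumeL_le (h : IsSelfConsistent g μ) (hB : 0 ≤ B) (hg : Profile B g) (ht : 0 ≤ t) :
    volumeL (profileAt g μ t) ≤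
      2 * volumeL (profileAt g μ 0) + 4 * (800 * (1 + B) ^ 3 + B) * t := by
  rcases le_total (800 * (1 + B) ^ 3 * t) (1 / g 0) with hsmall | hlarge
  · exact (h.volumeL_le_two_mul hB hg ht hsmall).trans (le_add_of_nonneg_right (by positivity))
  · have hinit : 0 ≤ volumeL (profileAt g μ 0) := by
      rw [volumeL_profileAt]
      exact pow_nonneg (div_nonneg (h.radiusSum_pos hg le_rfl).le
        (h.profileAt_zero_pos hg le_rfl).le) 3
    calc volumeL (profileAt g μ t) ≤ 4 * (1 / profileAt g μ t 0) := by
          simpa only [mul_one_div] using h.volumeL_le_div_profileAt_zero hg ht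
      _ ≤ 4 * (1 / g 0 + B * t) := by
          gcongr
          exact h.inv_profileAt_zero_le hB hg ht
      _ ≤ 2 * volumeL (profileAt g μ 0) + 4 * (800 * (1 + B) ^ 3 + B) * t := by linarith

end IsSelfConsistent

end Solution

/-! ### The profile of an initial datum -/

namespace MemE

variable {w₀ : ℝ → ℝ} {x y B : ℝ}

lemma exists_gt_pos (hw : MemE w₀) (hx : 0 ≤ x) (hpos : 0 < w₀ x) : ∃ y, x < y ∧ 0 < w₀ y := by
  have hev : ∀ᶠ y in 𝓝[>] x, 0 < w₀ y :=
    ((hw.rightCont x hx).eventually_const_lt hpos).filter_mono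
      (nhdsWithin_mono x Ioi_subset_Ici_self)
  exact (hev.and self_mem_nhdsWithin).exists.imp fun y hy => ⟨hy.2, hy.1⟩

lemma mem_betaDomain_iff (hw : MemE w₀) : x ∈ betaDomain w₀ ↔ 0 ≤ x ∧ 0 < w₀ x := by
  refine and_congr_right fun hx => ⟨fun hlt => ?_, fun hpos => ?_⟩
  · obtain ⟨_, ⟨y, hy, hwy, rfl⟩, hxy⟩ := lt_sSup_iff.1 hlt
    exact hwy.trans_le (hw.antitone hx hy (EReal.coe_lt_coe_iff.1 hxy).le)
  · obtain ⟨y, hxy, hwy⟩ := hw.exists_gt_pos hx hpos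
    exact (EReal.coe_lt_coe_iff.2 hxy).trans_le (le_supportEnd (hx.trans hxy.le) hwy)

lemma eventually_pos (hw : MemE w₀) (hx : 0 < x) (hpos : 0 < w₀ x) :
    ∀ᶠ z in 𝓝 x, 0 < z ∧ 0 < w₀ z := by
  obtain ⟨y, hxy, hwy⟩ := hw.exists_gt_pos hx.le hpos
  filter_upwards [Ioo_mem_nhds hx hxy] with z hz
  exact ⟨hz.1, hwy.trans_le (hw.antitone hz.1.le (hx.trans hxy).le hz.2.le)⟩

lemma integrableOn_Ioi (hw : MemE w₀) (hx : 0 ≤ x) : IntegrableOn w₀ (Ioi x) :=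
  hw.integrable.mono_set (Ioi_subset_Ioi hx)

lemma ae_nonneg (hw : MemE w₀) (hx : 0 ≤ x) : 0 ≤ᵐ[volume.restrict (Ioi x)] w₀ :=
  ae_restrict_of_forall_mem measurableSet_Ioi fun _ hy => hw.nonneg _ (hx.trans hy.le)

lemma tail_le_tail (hw : MemE w₀) (hx : 0 ≤ x) (hxy : x ≤ y) : tail w₀ y ≤ tail w₀ x :=
  setIntegral_mono_set (hw.integrableOn_Ioi hx) (hw.ae_nonneg hx)
    (Ioi_subset_Ioi hxy).eventuallyLE

lemma tail_pos (hw : MemE w₀) (hx : 0 ≤ x) (hpos : 0 < w₀ x) : 0 < tail w₀ x := by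
  obtain ⟨y, hxy, hwy⟩ := hw.exists_gt_pos hx hpos
  refine (setIntegral_pos_iff_support_of_nonneg_ae (hw.ae_nonneg hx) (hw.integrableOn_Ioi hx)).2 ?_
  refine lt_of_lt_of_le ?_ (measure_mono (show Ioc x y ⊆ Function.support w₀ ∩ Ioi x from
    fun z hz => ⟨(hwy.trans_le (hw.antitone (hx.trans hz.1.le) (hx.trans hxy.le) hz.2)).ne', hz.1⟩))
  simpa using hxy

lemma hasDerivWithinAt_tail (hw : MemE w₀) (hx : 0 ≤ x) :
    HasDerivWithinAt (tail w₀) (-w₀ x) (Ici x) x := by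
  have hmeas : StronglyMeasurableAtFilter w₀ (𝓝[Ioi x] x) volume :=
    ⟨Ioi x, self_mem_nhdsWithin, (hw.integrableOn_Ioi hx).aestronglyMeasurable⟩
  have hint : HasDerivWithinAt (fun y => ∫ z in x..y, w₀ z) (w₀ x) (Ici x) x :=
    intervalIntegral.integral_hasDerivWithinAt_right IntervalIntegrable.refl hmeas
      ((hw.rightCont x hx).mono Ioi_subset_Ici_self)
  have htail : ∀ y ∈ Ici x, tail w₀ y = tail w₀ x - ∫ z in x..y, w₀ z := fun y hxy => by
    rw [← intervalIntegral.integral_Ioi_sub_Ioi (hw.integrableOn_Ioi hx) hxy]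
    exact (sub_sub_cancel _ _).symm
  exact (hint.const_sub (tail w₀ x)).congr htail (htail x self_mem_Ici)

lemma contDiffAt_tail (hw : MemE w₀) (hc : ContDiffOn ℝ 2 (tail w₀) (betaDomain w₀)) (hx : 0 < x)
    (hpos : 0 < w₀ x) : ContDiffAt ℝ 2 (tail w₀) x := by
  refine hc.contDiffAt ?_
  filter_upwards [hw.eventually_pos hx hpos] with z hz
  exact hw.mem_betaDomain_iff.2 ⟨hz.1.le, hz.2⟩

lemma deriv_tail (hw : MemE w₀) (hc : ContDiffOn ℝ 2 (tail w₀) (betaDomain w₀)) (hx : 0 < x)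
    (hpos : 0 < w₀ x) : deriv (tail w₀) x = -w₀ x :=
  (uniqueDiffWithinAt_Ici x).eq_deriv _
    ((hw.contDiffAt_tail hc hx hpos).differentiableAt two_ne_zero).hasDerivAt.hasDerivWithinAt
    (hw.hasDerivWithinAt_tail hx.le)

lemma deriv_tail_eventuallyEq (hw : MemE w₀) (hc : ContDiffOn ℝ 2 (tail w₀) (betaDomain w₀))
    (hx : 0 < x) (hpos : 0 < w₀ x) : deriv (tail w₀) =ᶠ[𝓝 x] fun z => -w₀ z :=
  (hw.eventually_pos hx hpos).mono fun _ hz => hw.deriv_tail hc hz.1 hz.2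

lemma differentiableAt (hw : MemE w₀) (hc : ContDiffOn ℝ 2 (tail w₀) (betaDomain w₀)) (hx : 0 < x)
    (hpos : 0 < w₀ x) : DifferentiableAt ℝ w₀ x := by
  have hderiv : DifferentiableAt ℝ (deriv (tail w₀)) x :=
    ((hw.contDiffAt_tail hc hx hpos).derivWithin (m := 1) (by norm_num)).differentiableAt
      one_ne_zero
  simpa using (hderiv.congr_of_eventuallyEq (hw.deriv_tail_eventuallyEq hc hx hpos).symm).neg

lemma beta_eq (hw : MemE w₀) (hc : ContDiffOn ℝ 2 (tail w₀) (betaDomain w₀)) (hx : 0 < x)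
    (hpos : 0 < w₀ x) : beta w₀ x = -deriv w₀ x * tail w₀ x / w₀ x ^ 2 := by
  have hfirst := hw.deriv_tail_eventuallyEq hc hx hpos
  have hwithin : ∀ z > 0, derivWithin (tail w₀) (Ici 0) z = deriv (tail w₀) z := fun z hz =>
    derivWithin_of_mem_nhds (Ici_mem_nhds hz)
  have hsecond : iteratedDerivWithin 2 (tail w₀) (Ici 0) x = -deriv w₀ x := by
    rw [iteratedDerivWithin_succ, derivWithin_of_mem_nhds (Ici_mem_nhds hx), ← deriv.fun_neg]
    refine EventuallyEq.deriv_eq ?_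
    filter_upwards [hfirst, lt_mem_nhds hx] with z hz hz0
    rw [iteratedDerivWithin_one, hwithin z hz0, hz]
  rw [beta, hsecond, hwithin x hx, hfirst.eq_of_nhds, neg_sq]

lemma inv_sub_inv_le (hw : MemE w₀) (hc : ContDiffOn ℝ 2 (tail w₀) (betaDomain w₀))
    (hβ : ∀ x ∈ betaDomain w₀, beta w₀ x ≤ B) (hB : 0 ≤ B) (hx : 0 ≤ x) (hxy : x ≤ y)
    (hpos : 0 < w₀ y) : 1 / w₀ y - 1 / w₀ x ≤ B * (y - x) / tail w₀ y := by
  have hposz : ∀ z ∈ Icc x y, 0 < w₀ z := fun z hz =>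
    hpos.trans_le (hw.antitone (hx.trans hz.1) (hx.trans hxy) hz.2)
  have htail := hw.tail_pos (hx.trans hxy) hpos
  have hcont : ContinuousOn w₀ (Icc x y) := fun z hz => by
    rcases hz.1.eq_or_lt with rfl | hlt
    · exact (hw.rightCont x hx).mono Icc_subset_Ici_self
    · exact (hw.differentiableAt hc (hx.trans_lt hlt)
        (hposz z hz)).continuousAt.continuousWithinAt
  have hinv : ∀ z ∈ Ioo x y, HasDerivAt (fun z => 1 / w₀ z) (-deriv w₀ z / w₀ z ^ 2) z :=
    fun z hz => by
      have hwz := hposz z (Ioo_subset_Icc_self hz)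
      simpa only [one_div] using
        (hw.differentiableAt hc (hx.trans_lt hz.1) hwz).hasDerivAt.fun_inv hwz.ne'
  have hbound : ∀ z ∈ Ioo x y, -deriv w₀ z / w₀ z ^ 2 ≤ B / tail w₀ y := fun z hz => by
    have hz0 := hx.trans_lt hz.1
    have hwz := hposz z (Ioo_subset_Icc_self hz)
    have htz := hw.tail_le_tail hz0.le hz.2.le
    have hβz := hβ z (hw.mem_betaDomain_iff.2 ⟨hz0.le, hwz⟩)
    rw [hw.beta_eq hc hz0 hwz, mul_div_right_comm] at hβz
    exact ((le_div_iff₀ (htail.trans_le htz)).2 hβz).trans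
      (div_le_div_of_nonneg_left hB htail htz)
  have hmvt := (convex_Icc x y).image_sub_le_mul_sub_of_deriv_le (f := fun z => 1 / w₀ z)
    (continuousOn_const.div hcont fun z hz => (hposz z hz).ne')
    (fun z hz => (hinv z (by rwa [interior_Icc] at hz)).differentiableAt.differentiableWithinAt)
    (fun z hz => by
      rw [interior_Icc] at hz
      exact (hinv z hz).deriv.trans_le (hbound z hz))
    x (left_mem_Icc.2 hxy) y (right_mem_Icc.2 hxy) hxy
  exact hmvt.trans_eq (div_mul_eq_mul_div _ _ _)

lemma profile (hw : MemE w₀) (hm : ∫ x in Ioi (0 : ℝ), w₀ x = 1)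
    (hc : ContDiffOn ℝ 2 (tail w₀) (betaDomain w₀))
    (hβ : ∀ x ∈ betaDomain w₀, beta w₀ x ≤ B) (hB : 0 ≤ B) :
    Profile B fun x => w₀ (max x 0) := by
  have heq : ∀ x, 0 ≤ x → w₀ (max x 0) = w₀ x := fun x hx => by rw [max_eq_left hx]
  have heqOn : EqOn (fun x => w₀ (max x 0)) w₀ (Ioi 0) := fun x hx => heq x hx.le
  have hdiff : ∀ x, 0 < x → 0 < w₀ (max x 0) → DifferentiableAt ℝ (fun x => w₀ (max x 0)) x :=
    fun x hx hpos => (hw.differentiableAt hc hx (heq x hx.le ▸ hpos)).congr_of_eventuallyEq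
      (heqOn.eventuallyEq_of_mem (Ioi_mem_nhds hx))
  have hright : ∀ x, ContinuousWithinAt (fun x => w₀ (max x 0)) (Ici x) x := fun x =>
    (hw.rightCont (max x 0) (le_max_right _ _)).comp (f := fun x => max x 0)
      (by fun_prop) fun y hy => mem_Ici.2 (max_le_max_right 0 (mem_Ici.1 hy))
  exact
  { nonneg := fun x => hw.nonneg _ (le_max_right _ _)
    antitone := fun x y hxy =>
      hw.antitone (le_max_right x 0) (le_max_right y 0) (max_le_max_right 0 hxy)
    eq_of_nonpos := fun x hx => by rw [max_eq_right hx, max_self]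
    integrable := hw.integrable.congr_fun heqOn.symm measurableSet_Ioi
    integral_eq_one := (setIntegral_congr_fun measurableSet_Ioi heqOn).trans hm
    rightCont := hright
    continuousAt := fun x hpos => by
      rcases le_or_gt x 0 with hx | hx
      · refine continuousAt_iff_continuous_left_right.2 ⟨?_, hright x⟩
        exact (continuousWithinAt_const (b := w₀ 0)).congr
          (fun y (hy : y ≤ x) => by rw [max_eq_right (hy.trans hx)]) (by rw [max_eq_right hx])
      · exact (hdiff x hx hpos).continuousAt
    differentiableAt := hdiff
    inv_sub_inv_le := fun x y hx hxy hpos => by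
      have hy := hx.trans hxy
      have htail : tail (fun x => w₀ (max x 0)) y = tail w₀ y :=
        setIntegral_congr_fun measurableSet_Ioi fun z hz => heq z (hy.trans hz.le)
      rw [heq y hy] at hpos
      rw [heq y hy, heq x hx, htail]
      exact hw.inv_sub_inv_le hc hβ hB hx hxy hpos }

end MemE

end LSW

end

theorem proposition4p1 (βinf : ℝ) :
    ∃ C : ℝ, 0 < C ∧ ∀ w₀ : ℝ → ℝ,
      LSW.MemE w₀ →
      ∫ x in Set.Ioi (0 : ℝ), w₀ x = 1 →
      ContDiffOn ℝ 2 (LSW.tail w₀) (LSW.betaDomain w₀) →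
      (∀ x ∈ LSW.betaDomain w₀, LSW.beta w₀ x ≤ βinf) →
      ∃ w : ℝ → ℝ → ℝ, LSW.IsGlobalSolution w₀ w ∧
        ∀ t : ℝ, 0 ≤ t →
          LSW.volumeL (fun x => w x t) ≤ 2 * LSW.volumeL (fun x => w x 0) + C * t := by
  have hB : 0 ≤ max βinf 0 := le_max_right _ _
  refine ⟨4 * (800 * (1 + max βinf 0) ^ 3 + max βinf 0), by positivity,
    fun w₀ hw hm hc hβ => ?_⟩
  have hg := hw.profile hm hc (fun x hx => (hβ x hx).trans (le_max_left βinf 0)) hB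
  obtain ⟨μ, hμ⟩ := LSW.exists_isSelfConsistent hB hg
  exact ⟨_, hμ.isGlobalSolution hg fun x hx => by rw [max_eq_left hx],
    fun t ht => hμ.volumeL_le hB hg ht⟩
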